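/- Let $\theta\in(0,1]$ and let $a=(a_n)_{n\ge 1}$ be a positive, non-increasing sequence with $\sum_{n\ge1} a_n=1$. For a bounded set $F\subset\mathbb R$ let $\overline{\dim}_\theta F$ be the infimum of all $s\ge 0$ such that for every $\varepsilon>0$ there is $\delta_0>0$ such that for all $\delta\in(0,\delta_0]$ there is a cover $\{U_i\}$ of $F$ with $\delta^{1/\theta}\le |U_i|\le \delta$ for all $i$ and $\sum_i|U_i|^s\le\varepsilon$, where $|U|$ is the diameter of $U$. Let $\underline{\dim}_\theta F$ be the infimum of all $s\ge 0$ such that for every $\varepsilon>0$ and every $\delta_0>0$ such a cover exists for some $\delta\in(0,\delta_0]$. Let $\mathcal C_a$ be the family of all sets $[0,1]\setminus\bigcup_{j\ge1}U_j$, where the $U_j\subset[0,1]$ are pairwise disjoint open intervals with $|U_j|=a_j$. For a positive summable sequence $c=(c_n)_{n\ge1}$ put $x_n(c)=\sum_{i\ge n}c_i$, $s_n(c)=2^{-n}x_{2^n}(c)$ and $D_c=\{0\}\cup\{x_k(c):k\ge1\}$. Let $C_c$ be the Cantor set $\bigcap_{k\ge0}\bigcup_{j=1}^{2^k}I_{k,j}$,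 where $I_{0,1}=[0,x_1(c)]$ and, for each $k \geq 0$ and $1\le j\le 2^k$, one removes from the closed interval $I_{k,j}$ an open interval of length $c_{2^k+j-1}$, leaving the closed intervals $I_{k+1,2j-1}$ (left) and $I_{k+1,2j}$ (right), placed so that the length of every $I_{k,j}$ equals the total length of all gaps removed from it in this and all later steps. Suppose that $$2<\inf_{n\ge0}\frac{s_n(a)}{s_{n+1}(a)}\le\sup_{n\ge0}\frac{s_n(a)}{s_{n+1}(a)}<\infty .$$ Then for every $t\in[\overline{\dim}_\theta D_a,\overline{\dim}_\theta C_a]$ there is $E\in\mathcal C_a$ with $\overline{\dim}_\theta E=t$, and for every $t\in[\underline{\dim}_\theta D_a,\underline{\dim}_\theta C_a]$ there is $E'\in\mathcal C_a$ with $\underline{\dim}_\theta E'=t$. Moreover each of the sets $E$, $E'$ can be taken to be $D_a$, or $C_a$, or of the form $C_b\cup(r+D_{a'})$, where $b$ is an infinite subsequence of $a$, $a'$ is the infinite subsequence formed by the remaining terms, and $r=\sum_{n} b_n$. -/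

import Mathlib

/-!
Conventions: a sequence `a = (a_n)_{n ≥ 1}` is a function `a : ℕ → ℝ` of which only the values
`a n` with `1 ≤ n` are ever used; the value `a 0` plays no role.
-/

noncomputable section

/-- `F` has a cover `U_1, …, U_N` with `δ^(1/θ) ≤ |U_i| ≤ δ` and `∑ |U_i|^s ≤ ε`.
For `0 < θ` and `0 < δ` a cover with these properties is necessarily finite, since every term of
the sum is at least `(δ^(1/θ))^s > 0`.  The lower bound on the diameter also excludes
unbounded sets, for which `Metric.diam` takes the value `0`. -/
def HasIntermediateCover (θ δ s ε : ℝ) (F : Set ℝ) : Prop :=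
  ∃ (N : ℕ) (U : Fin N → Set ℝ), F ⊆ ⋃ i, U i ∧
    (∀ i, δ ^ (1 / θ) ≤ Metric.diam (U i) ∧ Metric.diam (U i) ≤ δ) ∧
    ∑ i, Metric.diam (U i) ^ s ≤ ε

/-- The lower `θ`-intermediate dimension of a bounded set `F ⊆ ℝ`, for `θ ∈ (0, 1]`. -/
def lowerIntermediateDim (θ : ℝ) (F : Set ℝ) : ℝ :=
  sInf {s : ℝ | 0 ≤ s ∧ ∀ ε > 0, ∀ δ₀ > 0, ∃ δ, 0 < δ ∧ δ ≤ δ₀ ∧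
    HasIntermediateCover θ δ s ε F}

/-- The upper `θ`-intermediate dimension of a bounded set `F ⊆ ℝ`, for `θ ∈ (0, 1]`. -/
def upperIntermediateDim (θ : ℝ) (F : Set ℝ) : ℝ :=
  sInf {s : ℝ | 0 ≤ s ∧ ∀ ε > 0, ∃ δ₀ > 0, ∀ δ, 0 < δ → δ ≤ δ₀ →
    HasIntermediateCover θ δ s ε F}

/-- `x_n(a) = ∑_{i ≥ n} a_i`. -/
def tailSum (a : ℕ → ℝ) (n : ℕ) : ℝ := ∑' i : ℕ, a (n + i)

/-- `s_n(a) = 2^{-n} x_{2^n}(a)`. -/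
def avgLength (a : ℕ → ℝ) (n : ℕ) : ℝ := tailSum a (2 ^ n) / 2 ^ n

/-- The class `𝒞_a`: all sets `[0,1] \ ⋃_{j ≥ 1} U_j`, where the `U_j ⊆ [0,1]` are pairwise
disjoint open intervals and `U_j = (l_j, l_j + a_j)` has length `a_j`.  Such sets are closed. -/
def complementarySets (a : ℕ → ℝ) : Set (Set ℝ) :=
  {E | ∃ l : ℕ → ℝ,
    (∀ j, 1 ≤ j → Set.Ioo (l j) (l j + a j) ⊆ Set.Icc 0 1) ∧
    (∀ i j, 1 ≤ i → 1 ≤ j → i ≠ j →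
      Disjoint (Set.Ioo (l i) (l i + a i)) (Set.Ioo (l j) (l j + a j))) ∧
    E = Set.Icc 0 1 \ ⋃ j ∈ Set.Ici 1, Set.Ioo (l j) (l j + a j)}

/-- The countable set `D_a = {0} ∪ {x_k(a) : k ≥ 1}`; the limit point `0` makes it closed. -/
def countableCompl (a : ℕ → ℝ) : Set ℝ :=
  insert 0 {x | ∃ k, 1 ≤ k ∧ x = tailSum a k}

/-- The gaps of the Cantor set are arranged in a binary tree: the root is `1`, and the interval
that carries the gap `a_m` is split into the intervals that carry the gaps `a_{2m}` (left) and
`a_{2m+1}` (right).  `cantorLength a m` is the total length of all gaps at or below `m`, which is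
the length of the interval carrying the gap `a_m`: the descendants of `m` in the `n`-th generation
are `m 2^n, …, m 2^n + 2^n - 1`. -/
def cantorLength (a : ℕ → ℝ) (m : ℕ) : ℝ :=
  ∑' n : ℕ, ∑ i ∈ Finset.range (2 ^ n), a (m * 2 ^ n + i)

/-- The left end point of the `j`-th closed interval of step `k` (`0 ≤ j < 2^k`).  This interval
carries the gap `a_{2^k + j}`; its left child starts at the same point, its right child after the
left child and the gap. -/
def cantorLeft (a : ℕ → ℝ) : ℕ → ℕ → ℝ
  | 0, _ => 0
  | k + 1, j => cantorLeft a k (j / 2) +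
      if j % 2 = 0 then 0 else cantorLength a (2 ^ (k + 1) + (j - 1)) + a (2 ^ k + j / 2)

/-- The `j`-th closed interval of step `k` (`0 ≤ j < 2^k`) in the construction of `C_a`. -/
def cantorInterval (a : ℕ → ℝ) (k j : ℕ) : Set ℝ :=
  Set.Icc (cantorLeft a k j) (cantorLeft a k j + cantorLength a (2 ^ k + j))

/-- The Cantor set `C_a`. -/
def cantorCompl (a : ℕ → ℝ) : Set ℝ :=
  ⋂ k : ℕ, ⋃ j ∈ Set.Iio (2 ^ k), cantorInterval a k j

/-- `E = C_b ∪ (r + D_{a'})`, where `b` is a subsequence of `a`, `a'` is the subsequence of the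
remaining terms, and `r` is the sum of `b`.  (`p 0 = q 0 = 0` keeps the indices starting at `1`.) -/
def IsCantorCountableUnion (a : ℕ → ℝ) (E : Set ℝ) : Prop :=
  ∃ p q : ℕ → ℕ, StrictMono p ∧ StrictMono q ∧ p 0 = 0 ∧ q 0 = 0 ∧
    (∀ n, 1 ≤ n → Xor (n ∈ Set.range p) (n ∈ Set.range q)) ∧
    E = cantorCompl (a ∘ p) ∪ (fun x => tailSum (a ∘ p) 1 + x) '' countableCompl (a ∘ q)

end

/-!
Upper and lower dimensions are treated together, the quantifier over the scales `δ` being abstracted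
as `IsScaleQuantifier`. For a slope `κ ≥ 1`, let `b` be the subsequence of `a` with positions
`⌈2 n^κ⌉`, let `a'` be the rest (`exists_index_splitting`), and consider
`E_κ = C_b ∪ (r + D_{a'})`.

* The hypothesis on the ratios makes `a` doubling, and `2^n a(N 2^n)` decay geometrically
  (`exists_geometric_decay`). At least every second index goes to `a'`, so `a'` is comparable to `a`
  term by term, and `D_{a'}` is bi-Lipschitz to `D_a` (`abs_countablePoint_sub_le`). Hence the
  countable part of `E_κ` has the same covers as `D_a`, whatever `κ` is.
* At step `m` the set `C_b` has `2^m` intervals, of length comparable to the term of `a` at position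
  `2^(κ m)`. By mass distribution (`exists_scale_of_cover_cantorCompl`) an efficient cover of `C_b`
  uses, up to constants, one scale `d` only. So `C_b` has covers at the scale `δ` with small
  `s`-sums if and only if there are `d ∈ [δ^(1/θ), δ]` and `n` with `a n ≤ d` and `n d^(κ s)` small
  (`hasIntermediateCover_cantorCompl`, `hasUniformScale_of_cover_cantorCompl`). This condition,
  `HasUniformScale`, depends on `κ` only through the exponent `κ s`.

Therefore the dimension of `E_κ` is the infimum of those `s` for which `(κ s, s)` lies in a fixed
upward closed set of pairs of exponents, `JointExponent`. At `κ = 1` it is at least the dimension of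
`C_a`, and as `κ → ∞` it falls to that of `D_a`; all values in between are taken by an elementary
argument about rays through the origin (`exists_slope_sInf_eq`). The joint condition at a common
scale `δ` is what makes this work for the lower dimension, which is not stable under finite unions.
That `E_κ` lies in `𝒞_a` follows by describing the gaps of `C_b` and `D_{a'}` explicitly
(`hasGaps_cantorCompl`, `hasGaps_countableCompl`, `HasGaps.union`).
-/

open Set Filter Topology

/-! ### Covers -/

theorem HasIntermediateCover.of_fintype {ι : Type*} [Fintype ι] {θ δ s ε : ℝ} {F : Set ℝ}
    (U : ι → Set ℝ) (hF : F ⊆ ⋃ i, U i)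
    (hd : ∀ i, δ ^ (1 / θ) ≤ Metric.diam (U i) ∧ Metric.diam (U i) ≤ δ)
    (hs : ∑ i, Metric.diam (U i) ^ s ≤ ε) : HasIntermediateCover θ δ s ε F := by
  refine ⟨Fintype.card ι, fun i => U ((Fintype.equivFin ι).symm i), ?_, fun i => hd _, ?_⟩
  · rwa [(Fintype.equivFin ι).symm.surjective.iUnion_comp]
  · rwa [Equiv.sum_comp (Fintype.equivFin ι).symm (fun i => Metric.diam (U i) ^ s)]

/-- Intervals of length `K d_i` may be cut into `K` admissible intervals of length `d_i`. -/
theorem HasIntermediateCover.of_intervals {ι : Type*} [Fintype ι] {θ δ s ε : ℝ} {F : Set ℝ}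
    (x d : ι → ℝ) (K : ℕ) (hK : 1 ≤ K) (hd0 : ∀ i, 0 < d i)
    (hd : ∀ i, δ ^ (1 / θ) ≤ d i ∧ d i ≤ δ)
    (hF : F ⊆ ⋃ i, Icc (x i) (x i + K * d i))
    (hs : K * ∑ i, d i ^ s ≤ ε) : HasIntermediateCover θ δ s ε F := by
  have hdiam : ∀ i : ι × Fin K, Metric.diam
      (Icc (x i.1 + (i.2 : ℕ) * d i.1) (x i.1 + (i.2 : ℕ) * d i.1 + d i.1)) = d i.1 := by
    intro i
    rw [Real.diam_Icc (by linarith [hd0 i.1])]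
    ring
  refine HasIntermediateCover.of_fintype (ι := ι × Fin K)
    (fun i => Icc (x i.1 + (i.2 : ℕ) * d i.1) (x i.1 + (i.2 : ℕ) * d i.1 + d i.1)) ?_ ?_ ?_
  · intro y hy
    obtain ⟨i, hi⟩ := mem_iUnion.1 (hF hy)
    have h0 : 0 ≤ (y - x i) / d i := div_nonneg (by linarith [hi.1]) (hd0 i).le
    have hy' : (y - x i) / d i * d i = y - x i := div_mul_cancel₀ _ (hd0 i).ne'
    rcases lt_or_ge ⌊(y - x i) / d i⌋₊ K with h | h
    · refine mem_iUnion.2 ⟨(i, ⟨_, h⟩), ?_⟩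
      have h1 := Nat.floor_le h0
      have h2 := Nat.lt_floor_add_one ((y - x i) / d i)
      have h3 := mul_le_mul_of_nonneg_right h1 (hd0 i).le
      have h4 := mul_le_mul_of_nonneg_right h2.le (hd0 i).le
      constructor <;> simp only <;> linarith
    · refine mem_iUnion.2 ⟨(i, ⟨K - 1, by omega⟩), ?_⟩
      have h1 : (K : ℝ) ≤ (y - x i) / d i := (Nat.le_floor_iff h0).1 h
      have h3 := mul_le_mul_of_nonneg_right h1 (hd0 i).le
      have h5 : ((K - 1 : ℕ) : ℝ) = K - 1 := by push_cast [hK]; ring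
      have h6 := hd0 i
      constructor <;> simp only [h5] <;> linarith [hi.2]
  · intro i
    rw [hdiam]
    exact hd _
  · simp only [hdiam]
    rw [Fintype.sum_prod_type]
    simpa [Finset.mul_sum] using hs

theorem HasIntermediateCover.mono_set {θ δ s ε : ℝ} {F F' : Set ℝ}
    (h : HasIntermediateCover θ δ s ε F) (hF : F' ⊆ F) : HasIntermediateCover θ δ s ε F' := by
  obtain ⟨N, U, h1, h2, h3⟩ := h
  exact ⟨N, U, hF.trans h1, h2, h3⟩

theorem HasIntermediateCover.mono {θ δ s s' ε ε' : ℝ} {F : Set ℝ}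
    (h : HasIntermediateCover θ δ s ε F) (hδ : 0 < δ) (hδ1 : δ ≤ 1) (hs : s ≤ s')
    (hε : ε ≤ ε') : HasIntermediateCover θ δ s' ε' F := by
  obtain ⟨N, U, h1, h2, h3⟩ := h
  refine ⟨N, U, h1, h2, (Finset.sum_le_sum fun i _ => ?_).trans (h3.trans hε)⟩
  exact Real.rpow_le_rpow_of_exponent_ge ((Real.rpow_pos_of_pos hδ _).trans_le (h2 i).1)
    ((h2 i).2.trans hδ1) hs

theorem HasIntermediateCover.union {θ δ s ε ε' : ℝ} {F F' : Set ℝ}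
    (h : HasIntermediateCover θ δ s ε F) (h' : HasIntermediateCover θ δ s ε' F') :
    HasIntermediateCover θ δ s (ε + ε') (F ∪ F') := by
  obtain ⟨N, U, h1, h2, h3⟩ := h
  obtain ⟨N', U', h1', h2', h3'⟩ := h'
  refine HasIntermediateCover.of_fintype (Sum.elim U U') ?_ ?_ ?_
  · rw [iUnion_sum]
    exact union_subset_union h1 h1'
  · rintro (i | i)
    exacts [h2 i, h2' i]
  · rw [Fintype.sum_sum_type]
    exact add_le_add h3 h3'

/-- A correspondence `u i ↦ v i` that expands distances at most by the factor `K` turns covers into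
covers at the same scale, at the cost of a constant factor in the sum. -/
theorem HasIntermediateCover.of_dist_le {ι : Type*} {θ δ s ε : ℝ} {u v : ι → ℝ} {K : ℕ}
    (hδ : 0 < δ) (hK : 1 ≤ K) (huv : ∀ i j, |v i - v j| ≤ K * |u i - u j|)
    (h : HasIntermediateCover θ δ s ε (range u)) :
    HasIntermediateCover θ δ s (2 * K * ε) (range v) := by
  classical
  obtain ⟨N, U, h1, h2, h3⟩ := h
  have hd0 : ∀ i, 0 < Metric.diam (U i) := fun i =>
    (Real.rpow_pos_of_pos hδ _).trans_le (h2 i).1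
  let x : Fin N → ℝ := fun i => if hi : ∃ j, u j ∈ U i then
    v hi.choose - K * Metric.diam (U i) else 0
  refine HasIntermediateCover.of_intervals x (fun i => Metric.diam (U i)) (2 * K) (by omega) hd0 h2
    ?_ ?_
  · rintro _ ⟨j, rfl⟩
    obtain ⟨i, hi⟩ := mem_iUnion.1 (h1 (mem_range_self j))
    refine mem_iUnion.2 ⟨i, ?_⟩
    have hex : ∃ j, u j ∈ U i := ⟨j, hi⟩
    have hx : x i = v hex.choose - K * Metric.diam (U i) := dif_pos hex
    -- an unbounded set has the junk diameter `0`, which the lower bound excludes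
    have hb : Bornology.IsBounded (U i) := by
      by_contra hb
      exact (hd0 i).ne' (Metric.diam_eq_zero_of_unbounded hb)
    have h4 : |u j - u hex.choose| ≤ Metric.diam (U i) :=
      Metric.dist_le_diam_of_mem hb hi hex.choose_spec
    have h5 := (huv j hex.choose).trans (mul_le_mul_of_nonneg_left h4 (Nat.cast_nonneg K))
    rw [abs_le] at h5
    rw [hx]
    push_cast
    constructor <;> linarith
  · push_cast
    exact mul_le_mul_of_nonneg_left h3 (by positivity)

theorem rpow_one_div_le_self {θ δ : ℝ} (hθ0 : 0 < θ) (hθ1 : θ ≤ 1) (hδ : 0 < δ) (hδ1 : δ ≤ 1) :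
    δ ^ (1 / θ) ≤ δ := by
  have := Real.rpow_le_rpow_of_exponent_ge hδ hδ1 (show 1 ≤ 1 / θ by rw [le_div_iff₀ hθ0]; linarith)
  simpa using this

theorem hasIntermediateCover_Icc_zero_one {θ δ : ℝ} (hθ0 : 0 < θ) (hθ1 : θ ≤ 1) (hδ : 0 < δ)
    (hδ1 : δ ≤ 1) : HasIntermediateCover θ δ 2 (2 * δ) (Icc 0 1) := by
  have h1 : 1 / δ ≤ ⌈1 / δ⌉₊ := Nat.le_ceil _
  have h2 : (⌈1 / δ⌉₊ : ℝ) < 1 / δ + 1 := Nat.ceil_lt_add_one (by positivity)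
  have h3 : 1 / δ * δ = 1 := by field_simp
  refine HasIntermediateCover.of_intervals (ι := Unit) (fun _ => 0) (fun _ => δ) ⌈1 / δ⌉₊
    (Nat.one_le_ceil_iff.2 (by positivity)) (fun _ => hδ)
    (fun _ => ⟨rpow_one_div_le_self hθ0 hθ1 hδ hδ1, le_rfl⟩) ?_ ?_
  · intro y hy
    refine mem_iUnion.2 ⟨(), hy.1, hy.2.trans ?_⟩
    have := mul_le_mul_of_nonneg_right h1 hδ.le
    linarith
  · simp only [Finset.univ_unique, Finset.sum_singleton, Real.rpow_two]
    have h4 := mul_le_mul_of_nonneg_right h2.le (sq_nonneg δ)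
    have h5 : (1 / δ + 1) * δ ^ 2 = δ + δ ^ 2 := by field_simp
    nlinarith

/-! ### Growth of the sequence -/

theorem tailSum_eq_add {c : ℕ → ℝ} (hc : Summable c) (n : ℕ) :
    tailSum c n = c n + tailSum c (n + 1) := by
  have h : Summable fun i => c (n + i) := by
    simpa [add_comm] using (summable_nat_add_iff n).2 hc
  unfold tailSum
  rw [h.tsum_eq_zero_add, add_zero]
  simp only [add_assoc, add_comm 1]

theorem tailSum_eq_sum_add {c : ℕ → ℝ} (hc : Summable c) (n k : ℕ) :
    tailSum c n = ∑ i ∈ Finset.range k, c (n + i) + tailSum c (n + k) := by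
  induction k with
  | zero => simp
  | succ k ih => rw [ih, tailSum_eq_add hc (n + k), Finset.sum_range_succ]; ring_nf

theorem tailSum_nonneg {c : ℕ → ℝ} (hc : ∀ n, 1 ≤ n → 0 < c n) {n : ℕ} (hn : 1 ≤ n) :
    0 ≤ tailSum c n :=
  tsum_nonneg fun i => (hc _ (by omega)).le

theorem tailSum_pos {c : ℕ → ℝ} (hs : Summable c) (hc : ∀ n, 1 ≤ n → 0 < c n) {n : ℕ}
    (hn : 1 ≤ n) : 0 < tailSum c n := by
  rw [tailSum_eq_add hs]
  linarith [hc n hn, tailSum_nonneg hc (show 1 ≤ n + 1 by omega)]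

theorem tailSum_antitone {c : ℕ → ℝ} (hs : Summable c) (hc : ∀ n, 1 ≤ n → 0 < c n) :
    AntitoneOn (tailSum c) (Ici 1) := by
  intro m hm n hn hmn
  obtain ⟨k, rfl⟩ := Nat.exists_eq_add_of_le hmn
  rw [tailSum_eq_sum_add hs m k]
  have : 0 ≤ ∑ i ∈ Finset.range k, c (m + i) :=
    Finset.sum_nonneg fun i _ => (hc _ (le_add_right hm)).le
  linarith

theorem tendsto_tailSum (c : ℕ → ℝ) : Tendsto (tailSum c) atTop (𝓝 0) := by
  have h : tailSum c = fun n => ∑' k, c (k + n) := by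
    funext n
    simp [tailSum, add_comm]
  rw [h]
  exact tendsto_sum_nat_add c

/-- Two-sided dyadic control of `a`: with `X k = x_{2^k}(a)`, the hypothesis on the ratios makes
`2^k a_{2^k}` comparable to `X k`, and `X` decays geometrically, neither too fast nor too slow. -/
theorem exists_dyadic_bounds {a : ℕ → ℝ} (hpos : ∀ n, 1 ≤ n → 0 < a n)
    (hanti : AntitoneOn a (Ici 1)) (hs : Summable a)
    (hinf : 2 < ⨅ n : ℕ, avgLength a n / avgLength a (n + 1))
    (hsup : BddAbove (range fun n : ℕ => avgLength a n / avgLength a (n + 1))) :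
    ∃ K ρ : ℝ, 1 ≤ K ∧ 0 < ρ ∧ ρ < 1 ∧
      (∀ k n, a (2 ^ (k + n)) ≤ K * (ρ / 2) ^ n * a (2 ^ k)) ∧
      ∀ k, a (2 ^ k) ≤ K * a (2 ^ (k + 1)) := by
  set X : ℕ → ℝ := fun k => tailSum a (2 ^ k) with hX
  have hXpos : ∀ k, 0 < X k := fun k => tailSum_pos hs hpos Nat.one_le_two_pow
  have hratio : ∀ n, avgLength a n / avgLength a (n + 1) = 2 * X n / X (n + 1) := by
    intro n
    have := (hXpos n).ne'
    have := (hXpos (n + 1)).ne'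
    simp only [avgLength]
    change X n / 2 ^ n / (X (n + 1) / 2 ^ (n + 1)) = _
    field_simp
    ring
  set I : ℝ := ⨅ n : ℕ, avgLength a n / avgLength a (n + 1) with hI
  obtain ⟨M, hM⟩ := hsup
  have hbdd : BddBelow (range fun n : ℕ => avgLength a n / avgLength a (n + 1)) := by
    refine ⟨0, ?_⟩
    rintro _ ⟨n, rfl⟩
    simp only [hratio]
    exact div_nonneg (by linarith [hXpos n]) (hXpos _).le
  have hlow : ∀ n, I * X (n + 1) ≤ 2 * X n := by
    intro n
    have := ciInf_le hbdd n
    rwa [hratio, le_div_iff₀ (hXpos _)] at this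
  have hup : ∀ n, 2 * X n ≤ M * X (n + 1) := by
    intro n
    have := hM (mem_range_self n)
    rwa [hratio, div_le_iff₀ (hXpos _)] at this
  have hM2 : 2 < M := by
    have h1 := (hlow 0).trans (hup 0)
    have := le_of_mul_le_mul_right h1 (hXpos 1)
    linarith
  have hIpos : 0 < I := by linarith
  set ρ : ℝ := 2 / I with hρ
  have hρ0 : 0 < ρ := by positivity
  have hρ1 : ρ < 1 := by rw [hρ, div_lt_one hIpos]; exact hinf
  have hstep : ∀ n, X (n + 1) ≤ ρ * X n := by
    intro n
    rw [hρ, div_mul_eq_mul_div, le_div_iff₀ hIpos]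
    linarith [hlow n]
  have hgeo : ∀ k n, X (k + n) ≤ ρ ^ n * X k := by
    intro k n
    induction n with
    | zero => simp
    | succ n ih =>
      calc X (k + n + 1) ≤ ρ * X (k + n) := hstep _
        _ ≤ ρ * (ρ ^ n * X k) := by gcongr
        _ = _ := by ring
  have hblock : ∀ k, X k = ∑ i ∈ Finset.range (2 ^ k), a (2 ^ k + i) + X (k + 1) := by
    intro k
    have := tailSum_eq_sum_add hs (2 ^ k) (2 ^ k)
    simp only [hX, pow_succ, mul_two]
    exact this
  clear_value ρ
  have hlo : ∀ k, (1 - ρ) * X k ≤ 2 ^ k * a (2 ^ k) := by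
    intro k
    have h1 : ∑ i ∈ Finset.range (2 ^ k), a (2 ^ k + i) ≤ 2 ^ k * a (2 ^ k) := by
      have := Finset.sum_le_card_nsmul (Finset.range (2 ^ k)) (fun i => a (2 ^ k + i)) (a (2 ^ k))
        (fun i _ => hanti (mem_Ici.2 Nat.one_le_two_pow)
          (mem_Ici.2 (le_add_right Nat.one_le_two_pow)) (by omega))
      simpa using this
    linarith [hblock k, hstep k]
  have hhi : ∀ k, 2 ^ k * a (2 ^ k) ≤ M * X k := by
    intro k
    cases k with
    | zero =>
      have h1 := tailSum_eq_add hs 1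
      have h2 := tailSum_nonneg hpos (show 1 ≤ 1 + 1 by omega)
      have h3 := hXpos 0
      simp only [hX, pow_zero] at h3 ⊢
      nlinarith
    | succ k =>
      have h1 : 2 ^ k * a (2 ^ (k + 1)) ≤ ∑ i ∈ Finset.range (2 ^ k), a (2 ^ k + i) := by
        have := Finset.card_nsmul_le_sum (Finset.range (2 ^ k)) (fun i => a (2 ^ k + i))
          (a (2 ^ (k + 1)))
          (fun i hi => hanti (mem_Ici.2 (le_add_right Nat.one_le_two_pow))
            (mem_Ici.2 Nat.one_le_two_pow) (by
              have := Finset.mem_range.1 hi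
              rw [pow_succ]; omega))
        simpa using this
      have h2 := hblock k
      have h3 := hup k
      have h4 := hXpos (k + 1)
      rw [pow_succ]
      linarith
  have hρ' : 0 < 1 - ρ := by linarith
  have hmain : ∀ k n, a (2 ^ (k + n)) ≤ M / (1 - ρ) * (ρ / 2) ^ n * a (2 ^ k) := by
    intro k n
    have h1 : 2 ^ (k + n) * a (2 ^ (k + n)) ≤ 2 ^ (k + n) *
        (M / (1 - ρ) * (ρ / 2) ^ n * a (2 ^ k)) := by
      calc 2 ^ (k + n) * a (2 ^ (k + n)) ≤ M * X (k + n) := hhi _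
        _ ≤ M * (ρ ^ n * X k) := by gcongr; exact hgeo k n
        _ ≤ M * (ρ ^ n * (2 ^ k * a (2 ^ k) / (1 - ρ))) := by
          gcongr
          rw [le_div_iff₀ hρ']
          linarith [hlo k]
        _ = _ := by
          rw [div_pow, pow_add]
          field_simp
    exact le_of_mul_le_mul_left h1 (by positivity)
  have hdbl : ∀ k, a (2 ^ k) ≤ M ^ 2 / (1 - ρ) * a (2 ^ (k + 1)) := by
    intro k
    have h1 : 2 ^ k * a (2 ^ k) ≤ 2 ^ k * (M ^ 2 / (1 - ρ) * a (2 ^ (k + 1))) := by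
      calc 2 ^ k * a (2 ^ k) ≤ M * X k := hhi _
        _ ≤ M * (M * X (k + 1) / 2) := by gcongr; linarith [hup k]
        _ ≤ M * (M * (2 ^ (k + 1) * a (2 ^ (k + 1)) / (1 - ρ)) / 2) := by
          gcongr
          rw [le_div_iff₀ hρ']
          linarith [hlo (k + 1)]
        _ = _ := by
          rw [pow_succ]
          field_simp
    exact le_of_mul_le_mul_left h1 (by positivity)
  have hMK : M / (1 - ρ) ≤ M ^ 2 / (1 - ρ) := by gcongr; nlinarith
  refine ⟨M ^ 2 / (1 - ρ), ρ, ?_, hρ0, hρ1, fun k n => (hmain k n).trans ?_, hdbl⟩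
  · rw [le_div_iff₀ hρ']
    nlinarith
  · have := hpos (2 ^ k) Nat.one_le_two_pow
    gcongr

theorem exists_geometric_decay {a : ℕ → ℝ} (hpos : ∀ n, 1 ≤ n → 0 < a n)
    (hanti : AntitoneOn a (Ici 1)) (hs : Summable a)
    (hinf : 2 < ⨅ n : ℕ, avgLength a n / avgLength a (n + 1))
    (hsup : BddAbove (range fun n : ℕ => avgLength a n / avgLength a (n + 1))) :
    ∃ K ρ : ℝ, 0 < K ∧ 0 < ρ ∧ ρ < 1 ∧
      (∀ N, 1 ≤ N → ∀ n, 2 ^ n * a (N * 2 ^ n) ≤ K * ρ ^ n * a N) ∧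
      ∀ N, 1 ≤ N → a N ≤ K * a (2 * N) := by
  obtain ⟨K, ρ, hK, hρ0, hρ1, h1, h2⟩ := exists_dyadic_bounds hpos hanti hs hinf hsup
  refine ⟨K ^ 2, ρ, by positivity, hρ0, hρ1, fun N hN n => ?_, fun N hN => ?_⟩
  · set k := Nat.log 2 N
    have hk1 : 2 ^ k ≤ N := Nat.pow_log_le_self 2 (by omega)
    have hk2 : N < 2 ^ (k + 1) := Nat.lt_pow_succ_log_self (by norm_num) N
    calc 2 ^ n * a (N * 2 ^ n) ≤ 2 ^ n * a (2 ^ (k + n)) := by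
          gcongr
          refine hanti (mem_Ici.2 Nat.one_le_two_pow)
            (mem_Ici.2 (Nat.mul_pos hN (by positivity))) ?_
          rw [pow_add]
          gcongr
      _ ≤ 2 ^ n * (K * (ρ / 2) ^ n * a (2 ^ k)) := by gcongr; exact h1 k n
      _ = K * ρ ^ n * a (2 ^ k) := by rw [div_pow]; field_simp
      _ ≤ K * ρ ^ n * (K * a (2 ^ (k + 1))) := by gcongr; exact h2 k
      _ ≤ K * ρ ^ n * (K * a N) := by
          gcongr
          exact hanti (mem_Ici.2 hN) (mem_Ici.2 Nat.one_le_two_pow) hk2.le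
      _ = _ := by ring
  · set k := Nat.log 2 N
    have hk1 : 2 ^ k ≤ N := Nat.pow_log_le_self 2 (by omega)
    have hk2 : N < 2 ^ (k + 1) := Nat.lt_pow_succ_log_self (by norm_num) N
    calc a N ≤ a (2 ^ k) := hanti (mem_Ici.2 Nat.one_le_two_pow) (mem_Ici.2 hN) hk1
      _ ≤ K * a (2 ^ (k + 1)) := h2 k
      _ ≤ K * (K * a (2 ^ (k + 1 + 1))) := by gcongr; exact h2 _
      _ ≤ K * (K * a (2 * N)) := by
          gcongr
          refine hanti (mem_Ici.2 (by omega)) (mem_Ici.2 Nat.one_le_two_pow) ?_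
          rw [pow_succ]; omega
      _ = _ := by ring

/-! ### Geometry of the Cantor sets -/

/-- The total length of the gaps exactly `n` generations below the node `m` of the binary tree. -/
noncomputable def generationSum (c : ℕ → ℝ) (m n : ℕ) : ℝ :=
  ∑ i ∈ Finset.range (2 ^ n), c (m * 2 ^ n + i)

theorem generationSum_succ (c : ℕ → ℝ) (m n : ℕ) :
    generationSum c m (n + 1) = generationSum c (2 * m) n + generationSum c (2 * m + 1) n := by
  unfold generationSum
  rw [pow_succ, mul_two, Finset.sum_range_add]
  congr 1 <;> refine Finset.sum_congr rfl fun i _ => ?_ <;> congr 1 <;> ring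

theorem generationSum_nonneg {c : ℕ → ℝ} (hc : ∀ n, 1 ≤ n → 0 < c n) {m : ℕ} (hm : 1 ≤ m)
    (n : ℕ) : 0 ≤ generationSum c m n :=
  Finset.sum_nonneg fun i _ => (hc _ (le_add_right (Nat.mul_pos hm (by positivity)))).le

theorem sum_generationSum_one (c : ℕ → ℝ) (n : ℕ) :
    ∑ k ∈ Finset.range n, generationSum c 1 k = ∑ i ∈ Finset.range (2 ^ n - 1), c (1 + i) := by
  induction n with
  | zero => simp
  | succ n ih =>
    have h : 2 ^ (n + 1) - 1 = (2 ^ n - 1) + 2 ^ n := by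
      have := Nat.one_le_two_pow (n := n); rw [pow_succ]; omega
    rw [Finset.sum_range_succ, ih, h, Finset.sum_range_add]
    congr 1
    refine Finset.sum_congr rfl fun i _ => ?_
    congr 1
    have := Nat.one_le_two_pow (n := n); omega

theorem hasSum_generationSum_one {c : ℕ → ℝ} (hs : Summable c) (hc : ∀ n, 1 ≤ n → 0 < c n) :
    HasSum (generationSum c 1) (tailSum c 1) := by
  have h1 : HasSum (fun i => c (1 + i)) (tailSum c 1) := by
    have h : Summable fun i => c (1 + i) := by
      simpa [add_comm] using (summable_nat_add_iff 1).2 hs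
    exact h.hasSum
  rw [hasSum_iff_tendsto_nat_of_nonneg (fun n => generationSum_nonneg hc le_rfl n)]
  simp only [sum_generationSum_one]
  have h2 : Tendsto (fun n : ℕ => 2 ^ n - 1) atTop atTop := by
    refine tendsto_atTop_mono (fun n => ?_) tendsto_id
    have := Nat.lt_two_pow_self (n := n)
    simp only [id]; omega
  exact h1.tendsto_sum_nat.comp h2

theorem summable_generationSum {c : ℕ → ℝ} (hs : Summable c) (hc : ∀ n, 1 ≤ n → 0 < c n) (m : ℕ)
    (hm : 1 ≤ m) : Summable (generationSum c m) := by
  induction m using Nat.strong_induction_on with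
  | _ m ih =>
    rcases Nat.lt_or_ge 1 m with h | h
    · have h1 := (summable_nat_add_iff 1).2 (ih (m / 2) (by omega) (by omega))
      refine Summable.of_nonneg_of_le (generationSum_nonneg hc hm) (fun n => ?_) h1
      rw [generationSum_succ]
      have h2 := generationSum_nonneg hc (show 1 ≤ 2 * (m / 2) by omega) n
      have h3 := generationSum_nonneg hc (show 1 ≤ 2 * (m / 2) + 1 by omega) n
      rcases Nat.mod_two_eq_zero_or_one m with h' | h'
      · rw [show 2 * (m / 2) = m by omega] at *; linarith
      · rw [show 2 * (m / 2) + 1 = m by omega] at *; linarith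
    · obtain rfl : m = 1 := by omega
      exact (hasSum_generationSum_one hs hc).summable

theorem cantorLength_one {c : ℕ → ℝ} (hs : Summable c) (hc : ∀ n, 1 ≤ n → 0 < c n) :
    cantorLength c 1 = tailSum c 1 :=
  (hasSum_generationSum_one hs hc).tsum_eq

theorem cantorLength_eq {c : ℕ → ℝ} (hs : Summable c) (hc : ∀ n, 1 ≤ n → 0 < c n) {m : ℕ}
    (hm : 1 ≤ m) :
    cantorLength c m = c m + cantorLength c (2 * m) + cantorLength c (2 * m + 1) := by
  have h1 := summable_generationSum hs hc (2 * m) (by omega)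
  have h2 := summable_generationSum hs hc (2 * m + 1) (by omega)
  change ∑' n, generationSum c m n = c m + ∑' n, generationSum c (2 * m) n +
    ∑' n, generationSum c (2 * m + 1) n
  rw [(summable_generationSum hs hc m hm).tsum_eq_zero_add, add_assoc, ← h1.tsum_add h2]
  simp only [generationSum_succ]
  simp [generationSum]

theorem cantorLength_pos {c : ℕ → ℝ} (hs : Summable c) (hc : ∀ n, 1 ≤ n → 0 < c n) {m : ℕ}
    (hm : 1 ≤ m) : 0 < cantorLength c m := by
  have h : ∀ m, 1 ≤ m → 0 ≤ cantorLength c m := fun m hm =>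
    tsum_nonneg fun n => generationSum_nonneg hc hm n
  rw [cantorLength_eq hs hc hm]
  linarith [hc m hm, h (2 * m) (by omega), h (2 * m + 1) (by omega)]

theorem le_cantorLength {c : ℕ → ℝ} (hs : Summable c) (hc : ∀ n, 1 ≤ n → 0 < c n) {m : ℕ}
    (hm : 1 ≤ m) : c m ≤ cantorLength c m := by
  rw [cantorLength_eq hs hc hm]
  linarith [cantorLength_pos hs hc (show 1 ≤ 2 * m by omega),
    cantorLength_pos hs hc (show 1 ≤ 2 * m + 1 by omega)]

theorem cantorLeft_even (c : ℕ → ℝ) (k j : ℕ) :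
    cantorLeft c (k + 1) (2 * j) = cantorLeft c k j := by
  simp [cantorLeft]

theorem cantorLeft_odd (c : ℕ → ℝ) (k j : ℕ) : cantorLeft c (k + 1) (2 * j + 1) =
    cantorLeft c k j + cantorLength c (2 * (2 ^ k + j)) + c (2 ^ k + j) := by
  have h1 : (2 * j + 1) / 2 = j := by omega
  have h2 : (2 * j + 1) % 2 = 1 := by omega
  have h3 : 2 ^ (k + 1) + 2 * j = 2 * (2 ^ k + j) := by ring
  simp [cantorLeft, h1, h3, h2, add_assoc]

theorem cantorInterval_even (c : ℕ → ℝ) (k j : ℕ) : cantorInterval c (k + 1) (2 * j) =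
    Icc (cantorLeft c k j) (cantorLeft c k j + cantorLength c (2 * (2 ^ k + j))) := by
  rw [cantorInterval, cantorLeft_even, show 2 ^ (k + 1) + 2 * j = 2 * (2 ^ k + j) by ring]

theorem cantorInterval_odd {c : ℕ → ℝ} (hs : Summable c) (hc : ∀ n, 1 ≤ n → 0 < c n) (k j : ℕ) :
    cantorInterval c (k + 1) (2 * j + 1) =
    Icc (cantorLeft c k j + cantorLength c (2 * (2 ^ k + j)) + c (2 ^ k + j))
      (cantorLeft c k j + cantorLength c (2 ^ k + j)) := by
  rw [cantorInterval, cantorLeft_odd,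
    show 2 ^ (k + 1) + (2 * j + 1) = 2 * (2 ^ k + j) + 1 by ring,
    cantorLength_eq hs hc (show 1 ≤ 2 ^ k + j from le_add_right Nat.one_le_two_pow)]
  congr 1
  ring

theorem cantorLeft_add_length_lt {c : ℕ → ℝ} (hs : Summable c) (hc : ∀ n, 1 ≤ n → 0 < c n)
    (k j : ℕ) (hj : j + 1 < 2 ^ k) :
    cantorLeft c k j + cantorLength c (2 ^ k + j) < cantorLeft c k (j + 1) := by
  induction k generalizing j with
  | zero => simp at hj
  | succ k ih =>
    rw [pow_succ] at hj
    obtain ⟨i, rfl | rfl⟩ : ∃ i, j = 2 * i ∨ j = 2 * i + 1 := ⟨j / 2, by omega⟩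
    · rw [cantorLeft_even, cantorLeft_odd, show 2 ^ (k + 1) + 2 * i = 2 * (2 ^ k + i) by ring]
      linarith [hc (2 ^ k + i) (le_add_right Nat.one_le_two_pow)]
    · rw [show 2 * i + 1 + 1 = 2 * (i + 1) by ring, cantorLeft_even, cantorLeft_odd,
        show 2 ^ (k + 1) + (2 * i + 1) = 2 * (2 ^ k + i) + 1 by ring]
      have h1 := ih i (by omega)
      rw [cantorLength_eq hs hc (show 1 ≤ 2 ^ k + i from le_add_right Nat.one_le_two_pow)] at h1
      linarith

theorem cantorLeft_le {c : ℕ → ℝ} (hs : Summable c) (hc : ∀ n, 1 ≤ n → 0 < c n)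
    (k i j : ℕ) (hij : i ≤ j) (hj : j < 2 ^ k) : cantorLeft c k i ≤ cantorLeft c k j := by
  induction j, hij using Nat.le_induction with
  | base => exact le_rfl
  | succ j hij ih =>
    have h1 := cantorLeft_add_length_lt hs hc k j hj
    have h2 := cantorLength_pos hs hc (show 1 ≤ 2 ^ k + j from le_add_right Nat.one_le_two_pow)
    linarith [ih (by omega)]

theorem cantorLeft_add_length_lt_of_lt {c : ℕ → ℝ} (hs : Summable c) (hc : ∀ n, 1 ≤ n → 0 < c n)
    (k i j : ℕ) (hij : i < j) (hj : j < 2 ^ k) :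
    cantorLeft c k i + cantorLength c (2 ^ k + i) < cantorLeft c k j :=
  (cantorLeft_add_length_lt hs hc k i (by omega)).trans_le (cantorLeft_le hs hc k _ j hij hj)

/-- The union of the closed intervals of step `k`. -/
def cantorUnion (c : ℕ → ℝ) (k : ℕ) : Set ℝ := ⋃ j ∈ Iio (2 ^ k), cantorInterval c k j

theorem mem_cantorUnion {c : ℕ → ℝ} {k : ℕ} {x : ℝ} :
    x ∈ cantorUnion c k ↔ ∃ j < 2 ^ k, x ∈ cantorInterval c k j := by
  simp [cantorUnion]

/-- The gap removed from the `j`-th interval of step `k`. -/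
def cantorGap (c : ℕ → ℝ) (k j : ℕ) : Set ℝ :=
  Ioo (cantorLeft c k j + cantorLength c (2 * (2 ^ k + j)))
    (cantorLeft c k j + cantorLength c (2 * (2 ^ k + j)) + c (2 ^ k + j))

theorem cantorGap_subset {c : ℕ → ℝ} (hs : Summable c) (hc : ∀ n, 1 ≤ n → 0 < c n) (k j : ℕ) :
    cantorGap c k j ⊆ cantorInterval c k j := by
  have h0 : 1 ≤ 2 ^ k + j := le_add_right Nat.one_le_two_pow
  intro x hx
  rw [cantorInterval, cantorLength_eq hs hc h0]
  have h1 := cantorLength_pos hs hc (show 1 ≤ 2 * (2 ^ k + j) by omega)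
  have h2 := cantorLength_pos hs hc (show 1 ≤ 2 * (2 ^ k + j) + 1 by omega)
  constructor <;> linarith [hx.1, hx.2]

theorem cantorInterval_eq_of_mem {c : ℕ → ℝ} (hs : Summable c) (hc : ∀ n, 1 ≤ n → 0 < c n)
    {k i j : ℕ} (hi : i < 2 ^ k) (hj : j < 2 ^ k) {x : ℝ} (hxi : x ∈ cantorInterval c k i)
    (hxj : x ∈ cantorInterval c k j) : i = j := by
  rcases lt_trichotomy i j with h | h | h
  · linarith [cantorLeft_add_length_lt_of_lt hs hc k i j h hj, hxi.2, hxj.1]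
  · exact h
  · linarith [cantorLeft_add_length_lt_of_lt hs hc k j i h hi, hxj.2, hxi.1]

theorem mem_cantorUnion_succ {c : ℕ → ℝ} (hs : Summable c) (hc : ∀ n, 1 ≤ n → 0 < c n) {k : ℕ}
    {x : ℝ} : x ∈ cantorUnion c (k + 1) ↔
      ∃ j < 2 ^ k, x ∈ cantorInterval c k j \ cantorGap c k j := by
  rw [mem_cantorUnion]
  have hlen : ∀ j, cantorLength c (2 ^ k + j) = c (2 ^ k + j) + cantorLength c (2 * (2 ^ k + j)) +
      cantorLength c (2 * (2 ^ k + j) + 1) := fun j =>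
    cantorLength_eq hs hc (le_add_right Nat.one_le_two_pow)
  have hp1 : ∀ j, 0 < cantorLength c (2 * (2 ^ k + j)) := fun j =>
    cantorLength_pos hs hc (by have := Nat.one_le_two_pow (n := k); omega)
  have hp2 : ∀ j, 0 < cantorLength c (2 * (2 ^ k + j) + 1) := fun j =>
    cantorLength_pos hs hc (by omega)
  have hp3 : ∀ j, 0 < c (2 ^ k + j) := fun j => hc _ (le_add_right Nat.one_le_two_pow)
  constructor
  · rintro ⟨j, hj, hx⟩
    rw [pow_succ] at hj
    refine ⟨j / 2, by omega, ?_⟩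
    obtain ⟨i, rfl | rfl⟩ : ∃ i, j = 2 * i ∨ j = 2 * i + 1 := ⟨j / 2, by omega⟩
    · rw [show 2 * i / 2 = i by omega]
      rw [cantorInterval_even] at hx
      refine ⟨⟨hx.1, ?_⟩, fun h => ?_⟩
      · rw [hlen]; linarith [hx.2, hp2 i, hp3 i]
      · linarith [hx.2, h.1]
    · rw [show (2 * i + 1) / 2 = i by omega]
      rw [cantorInterval_odd hs hc] at hx
      refine ⟨⟨?_, hx.2⟩, fun h => ?_⟩
      · linarith [hx.1, hp1 i, hp3 i]
      · linarith [hx.1, h.2]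
  · rintro ⟨j, hj, hx, hg⟩
    rcases le_or_gt x (cantorLeft c k j + cantorLength c (2 * (2 ^ k + j))) with h | h
    · refine ⟨2 * j, by rw [pow_succ]; omega, ?_⟩
      rw [cantorInterval_even]
      exact ⟨hx.1, h⟩
    · refine ⟨2 * j + 1, by rw [pow_succ]; omega, ?_⟩
      rw [cantorInterval_odd hs hc]
      refine ⟨not_lt.1 fun h' => hg ⟨h, h'⟩, hx.2⟩

theorem cantorUnion_succ_subset {c : ℕ → ℝ} (hs : Summable c) (hc : ∀ n, 1 ≤ n → 0 < c n) (k : ℕ) :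
    cantorUnion c (k + 1) ⊆ cantorUnion c k := by
  intro x hx
  obtain ⟨j, hj, h⟩ := (mem_cantorUnion_succ hs hc).1 hx
  exact mem_cantorUnion.2 ⟨j, hj, h.1⟩

theorem cantorUnion_antitone {c : ℕ → ℝ} (hs : Summable c) (hc : ∀ n, 1 ≤ n → 0 < c n) :
    Antitone (cantorUnion c) :=
  antitone_nat_of_succ_le (cantorUnion_succ_subset hs hc)

theorem cantorCompl_eq_iInter (c : ℕ → ℝ) : cantorCompl c = ⋂ k, cantorUnion c k := rfl

theorem cantorLeft_add_pow (c : ℕ → ℝ) (k n j : ℕ) :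
    cantorLeft c (k + n) (j * 2 ^ n) = cantorLeft c k j := by
  induction n with
  | zero => simp
  | succ n ih =>
    rw [← ih, ← cantorLeft_even c (k + n), ← add_assoc, pow_succ]
    congr 1
    ring

theorem cantorLeft_mem {c : ℕ → ℝ} (hs : Summable c) (hc : ∀ n, 1 ≤ n → 0 < c n)
    (k j : ℕ) (hj : j < 2 ^ k) : cantorLeft c k j ∈ cantorCompl c := by
  rw [cantorCompl_eq_iInter, mem_iInter]
  intro n
  refine cantorUnion_antitone hs hc (show n ≤ k + n by omega) ?_
  refine mem_cantorUnion.2 ⟨j * 2 ^ n, ?_, ?_⟩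
  · rw [pow_add]
    exact Nat.mul_lt_mul_of_pos_right hj (by positivity)
  · have := cantorLength_pos hs hc (show 1 ≤ 2 ^ (k + n) + j * 2 ^ n from
      le_add_right Nat.one_le_two_pow)
    rw [cantorInterval, cantorLeft_add_pow]
    constructor <;> linarith

theorem disjoint_cantorGap_cantorUnion {c : ℕ → ℝ} (hs : Summable c) (hc : ∀ n, 1 ≤ n → 0 < c n)
    {k j : ℕ} (hj : j < 2 ^ k) : Disjoint (cantorGap c k j) (cantorUnion c (k + 1)) := by
  rw [Set.disjoint_left]
  intro x hx hx'
  obtain ⟨i, hi, h1, h2⟩ := (mem_cantorUnion_succ hs hc).1 hx'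
  rw [cantorInterval_eq_of_mem hs hc hi hj h1 (cantorGap_subset hs hc k j hx)] at h2
  exact h2 hx

theorem cantorGap_subset_cantorUnion {c : ℕ → ℝ} (hs : Summable c) (hc : ∀ n, 1 ≤ n → 0 < c n)
    {k j : ℕ} (hj : j < 2 ^ k) : cantorGap c k j ⊆ cantorUnion c k := fun _ hx =>
  mem_cantorUnion.2 ⟨j, hj, cantorGap_subset hs hc k j hx⟩

theorem disjoint_cantorGap {c : ℕ → ℝ} (hs : Summable c) (hc : ∀ n, 1 ≤ n → 0 < c n)
    {k j k' j' : ℕ} (hj : j < 2 ^ k) (hj' : j' < 2 ^ k') (h : (k, j) ≠ (k', j')) :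
    Disjoint (cantorGap c k j) (cantorGap c k' j') := by
  rcases lt_trichotomy k k' with hk | rfl | hk
  · exact (disjoint_cantorGap_cantorUnion hs hc hj).mono_right
      ((cantorGap_subset_cantorUnion hs hc hj').trans (cantorUnion_antitone hs hc hk))
  · rw [Set.disjoint_left]
    intro x hx hx'
    exact h (by rw [cantorInterval_eq_of_mem hs hc hj hj' (cantorGap_subset hs hc _ _ hx)
      (cantorGap_subset hs hc _ _ hx')])
  · exact ((disjoint_cantorGap_cantorUnion hs hc hj').mono_right
      ((cantorGap_subset_cantorUnion hs hc hj).trans (cantorUnion_antitone hs hc hk))).symm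

/-! ### Sets with prescribed gap lengths -/

/-- `E` arises from the interval `[x, y]` by removing disjoint open intervals of the lengths
`c 1, c 2, …`. -/
def HasGaps (c : ℕ → ℝ) (x y : ℝ) (E : Set ℝ) : Prop :=
  ∃ l : ℕ → ℝ,
    (∀ j, 1 ≤ j → Ioo (l j) (l j + c j) ⊆ Icc x y) ∧
    (∀ i j, 1 ≤ i → 1 ≤ j → i ≠ j → Disjoint (Ioo (l i) (l i + c i)) (Ioo (l j) (l j + c j))) ∧
    E = Icc x y \ ⋃ j ∈ Ici 1, Ioo (l j) (l j + c j)

theorem hasGaps_cantorCompl {c : ℕ → ℝ} (hs : Summable c) (hc : ∀ n, 1 ≤ n → 0 < c n) :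
    HasGaps c 0 (tailSum c 1) (cantorCompl c) := by
  have hk : ∀ m, 1 ≤ m → 2 ^ Nat.log 2 m ≤ m := fun m hm => Nat.pow_log_le_self 2 (by omega)
  have hj : ∀ m, 1 ≤ m → m - 2 ^ Nat.log 2 m < 2 ^ Nat.log 2 m := by
    intro m hm
    have := Nat.lt_pow_succ_log_self (b := 2) (by norm_num) m
    rw [pow_succ] at this
    have := hk m hm
    omega
  have hstep0 : cantorUnion c 0 = Icc 0 (tailSum c 1) := by
    ext x
    rw [mem_cantorUnion]
    simp [cantorInterval, cantorLeft, cantorLength_one hs hc]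
  let l : ℕ → ℝ := fun m =>
    cantorLeft c (Nat.log 2 m) (m - 2 ^ Nat.log 2 m) + cantorLength c (2 * m)
  have hl : ∀ m, 1 ≤ m → Ioo (l m) (l m + c m) =
      cantorGap c (Nat.log 2 m) (m - 2 ^ Nat.log 2 m) := by
    intro m hm
    rw [cantorGap, Nat.add_sub_cancel' (hk m hm)]
  refine ⟨l, ?_, ?_, ?_⟩
  · intro m hm
    rw [hl m hm, ← hstep0]
    exact (cantorGap_subset_cantorUnion hs hc (hj m hm)).trans
      (cantorUnion_antitone hs hc (Nat.zero_le _))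
  · intro m n hm hn hmn
    rw [hl m hm, hl n hn]
    refine disjoint_cantorGap hs hc (hj m hm) (hj n hn) fun h => hmn ?_
    have h1 := congrArg Prod.fst h
    have h2 := congrArg Prod.snd h
    simp only at h1 h2
    have h3 := hk m hm
    have h4 := hk n hn
    rw [h1] at h2 h3
    omega
  · ext x
    rw [cantorCompl_eq_iInter, mem_iInter]
    constructor
    · intro hx
      refine ⟨hstep0 ▸ hx 0, fun hmem => ?_⟩
      simp only [mem_iUnion] at hmem
      obtain ⟨m, hm, hxm⟩ := hmem
      rw [hl m hm] at hxm
      exact Set.disjoint_left.1 (disjoint_cantorGap_cantorUnion hs hc (hj m hm)) hxm (hx _)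
    · rintro ⟨hx, hmem⟩ k
      induction k with
      | zero => rwa [hstep0]
      | succ k ih =>
        obtain ⟨j, hjk, hxj⟩ := mem_cantorUnion.1 ih
        refine (mem_cantorUnion_succ hs hc).2 ⟨j, hjk, hxj, fun hg => hmem ?_⟩
        have h1 : 1 ≤ 2 ^ k + j := le_add_right Nat.one_le_two_pow
        have h2 : Nat.log 2 (2 ^ k + j) = k :=
          Nat.log_eq_of_pow_le_of_lt_pow (by omega) (by rw [pow_succ]; omega)
        simp only [mem_iUnion]
        refine ⟨2 ^ k + j, h1, ?_⟩
        rw [hl _ h1, h2]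
        simpa using hg

/-- The points `0, x_1(c), x_2(c), …` of `D_c`, indexed so that `0` comes first. -/
noncomputable def countablePoint (c : ℕ → ℝ) (k : ℕ) : ℝ := if k = 0 then 0 else tailSum c k

theorem countableCompl_eq_range (c : ℕ → ℝ) : countableCompl c = range (countablePoint c) := by
  ext x
  simp only [countableCompl, mem_insert_iff, mem_ofPred_eq, mem_range, countablePoint]
  constructor
  · rintro (rfl | ⟨k, hk, rfl⟩)
    · exact ⟨0, by simp⟩
    · exact ⟨k, by rw [if_neg (by omega)]⟩
  · rintro ⟨k, rfl⟩
    by_cases hk : k = 0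
    · simp [hk]
    · exact Or.inr ⟨k, by omega, by simp [hk]⟩

theorem hasGaps_countableCompl {c : ℕ → ℝ} (hs : Summable c) (hc : ∀ n, 1 ≤ n → 0 < c n) (r : ℝ) :
    HasGaps c r (r + tailSum c 1) ((fun x => r + x) '' countableCompl c) := by
  have hanti := tailSum_antitone hs hc
  have hIoo : ∀ j, Ioo (r + tailSum c (j + 1)) (r + tailSum c (j + 1) + c j) =
      Ioo (r + tailSum c (j + 1)) (r + tailSum c j) := by
    intro j
    rw [tailSum_eq_add hs j]
    congr 1
    ring
  refine ⟨fun j => r + tailSum c (j + 1), ?_, ?_, ?_⟩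
  · intro j hj
    rw [hIoo]
    intro x hx
    have h1 := tailSum_nonneg hc (show 1 ≤ j + 1 by omega)
    have h2 := hanti (mem_Ici.2 le_rfl) (mem_Ici.2 hj) hj
    constructor <;> linarith [hx.1, hx.2]
  · have key : ∀ i j, 1 ≤ i → i < j → Disjoint
        (Ioo (r + tailSum c (i + 1)) (r + tailSum c (i + 1) + c i))
        (Ioo (r + tailSum c (j + 1)) (r + tailSum c (j + 1) + c j)) := by
      intro i j hi hij
      rw [hIoo, hIoo, Set.disjoint_left]
      intro x hx hx'
      have := hanti (mem_Ici.2 (show 1 ≤ i + 1 by omega)) (mem_Ici.2 (show 1 ≤ j by omega)) hij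
      linarith [hx.1, hx'.2]
    intro i j hi hj hij
    rcases lt_or_gt_of_ne hij with h | h
    · exact key i j hi h
    · exact (key j i hj h).symm
  · ext x
    simp only [hIoo]
    constructor
    · rintro ⟨y, hy, rfl⟩
      rw [countableCompl] at hy
      have h1 := tailSum_nonneg hc (le_refl 1)
      rcases hy with rfl | ⟨k, hk, rfl⟩
      · refine ⟨⟨by simp, by simpa using h1⟩, fun hmem => ?_⟩
        simp only [mem_iUnion] at hmem
        obtain ⟨m, hm, hxm⟩ := hmem
        have := tailSum_nonneg hc (show 1 ≤ m + 1 by omega)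
        linarith [hxm.1]
      · refine ⟨⟨by linarith [tailSum_nonneg hc hk],
          by linarith [hanti (mem_Ici.2 le_rfl) (mem_Ici.2 hk) hk]⟩, fun hmem => ?_⟩
        simp only [mem_iUnion] at hmem
        obtain ⟨m, hm, hxm⟩ := hmem
        rcases Nat.lt_or_ge m k with h | h
        · linarith [hxm.1, hanti (mem_Ici.2 (show 1 ≤ m + 1 by omega)) (mem_Ici.2 hk) h]
        · linarith [hxm.2, hanti (mem_Ici.2 hk) (mem_Ici.2 hm) h]
    · rintro ⟨hx, hmem⟩
      refine ⟨x - r, ?_, by ring⟩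
      simp only [mem_iUnion, not_exists] at hmem
      rcases eq_or_lt_of_le (show 0 ≤ x - r by linarith [hx.1]) with h0 | h0
      · exact Or.inl h0.symm
      · right
        -- the largest `k` with `x - r ≤ x_k(c)`; it exists since the tails tend to `0`
        have hev : ∃ m, tailSum c (m + 1) < x - r := by
          have h1 := ((tendsto_tailSum c).comp (tendsto_add_atTop_nat 1)).eventually
            (gt_mem_nhds h0)
          exact h1.exists
        classical
        have hfind := Nat.find_spec hev
        rcases Nat.eq_zero_or_pos (Nat.find hev) with hz | hz
        · rw [hz] at hfind
          linarith [hx.2]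
        · refine ⟨Nat.find hev, hz, ?_⟩
          have hmin := Nat.find_min hev (show Nat.find hev - 1 < Nat.find hev by omega)
          rw [Nat.sub_add_cancel hz, not_lt] at hmin
          by_contra hne
          refine hmem (Nat.find hev) hz ⟨by linarith, ?_⟩
          linarith [lt_of_le_of_ne hmin hne]

theorem Ioo_subset_of_Ioo_subset_Icc {u v x y : ℝ} (h : Ioo u v ⊆ Icc x y) :
    Ioo u v ⊆ Ioo x y := by
  rw [← interior_Icc (a := x)]
  exact interior_maximal h isOpen_Ioo

theorem HasGaps.union {a : ℕ → ℝ} {p q : ℕ → ℕ} (hp : StrictMono p) (hq : StrictMono q)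
    (hp0 : p 0 = 0) (hq0 : q 0 = 0)
    (hpq : ∀ n, 1 ≤ n → Xor (n ∈ range p) (n ∈ range q)) {x y z : ℝ} (hxy : x ≤ y) (hyz : y ≤ z)
    {E E' : Set ℝ} (h : HasGaps (a ∘ p) x y E) (h' : HasGaps (a ∘ q) y z E') :
    HasGaps a x z (E ∪ E') := by
  classical
  obtain ⟨l, hl1, hl2, rfl⟩ := h
  obtain ⟨l', hl1', hl2', rfl⟩ := h'
  let L : ℕ → ℝ := fun n =>
    if n ∈ range p then l (Function.invFun p n) else l' (Function.invFun q n)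
  have hLp : ∀ n, L (p n) = l n := by
    intro n
    simp only [L, mem_range_self, if_true]
    rw [Function.leftInverse_invFun hp.injective n]
  have hLq : ∀ n, 1 ≤ n → L (q n) = l' n := by
    intro n hn
    have h1 : 1 ≤ q n := by
      have := hq (show 0 < n by omega); omega
    have h2 : q n ∉ range p := by
      rcases hpq _ h1 with h | h
      · exact absurd (mem_range_self n) h.2
      · exact h.2
    simp only [L, if_neg h2]
    rw [Function.leftInverse_invFun hq.injective n]
  have hcases : ∀ m, 1 ≤ m → (∃ n, 1 ≤ n ∧ p n = m) ∨ ∃ n, 1 ≤ n ∧ q n = m := by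
    intro m hm
    rcases hpq m hm with h | h
    · obtain ⟨n, rfl⟩ := h.1
      exact Or.inl ⟨n, Nat.one_le_iff_ne_zero.2 (by rintro rfl; omega), rfl⟩
    · obtain ⟨n, rfl⟩ := h.1
      exact Or.inr ⟨n, Nat.one_le_iff_ne_zero.2 (by rintro rfl; omega), rfl⟩
  have hp1 : ∀ n, 1 ≤ n → 1 ≤ p n := fun n hn => hn.trans hp.le_apply
  have hq1 : ∀ n, 1 ≤ n → 1 ≤ q n := fun n hn => hn.trans hq.le_apply
  have hIp : ∀ n, 1 ≤ n → Ioo (L (p n)) (L (p n) + a (p n)) ⊆ Ioo x y := fun n hn => by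
    rw [hLp]; exact Ioo_subset_of_Ioo_subset_Icc (hl1 n hn)
  have hIq : ∀ n, 1 ≤ n → Ioo (L (q n)) (L (q n) + a (q n)) ⊆ Ioo y z := fun n hn => by
    rw [hLq n hn]; exact Ioo_subset_of_Ioo_subset_Icc (hl1' n hn)
  have hd : Disjoint (Ioo x y) (Ioo y z) := by
    rw [Set.disjoint_left]
    intro w hw hw'
    linarith [hw.2, hw'.1]
  refine ⟨L, ?_, ?_, ?_⟩
  · intro m hm
    rcases hcases m hm with ⟨n, hn, rfl⟩ | ⟨n, hn, rfl⟩
    · exact (hIp n hn).trans (Ioo_subset_Icc_self.trans (Icc_subset_Icc_right hyz))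
    · exact (hIq n hn).trans (Ioo_subset_Icc_self.trans (Icc_subset_Icc_left hxy))
  · intro i j hi hj hij
    rcases hcases i hi with ⟨n, hn, rfl⟩ | ⟨n, hn, rfl⟩ <;>
      rcases hcases j hj with ⟨m, hm, rfl⟩ | ⟨m, hm, rfl⟩
    · rw [hLp, hLp]
      exact hl2 n m hn hm (fun h => hij (by rw [h]))
    · exact hd.mono (hIp n hn) (hIq m hm)
    · exact (hd.mono (hIp m hm) (hIq n hn)).symm
    · rw [hLq n hn, hLq m hm]
      exact hl2' n m hn hm (fun h => hij (by rw [h]))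
  · ext w
    simp only [mem_union, Set.mem_sdiff, mem_iUnion, mem_Ici, not_exists, Function.comp]
    constructor
    · rintro (⟨hw, hno⟩ | ⟨hw, hno⟩)
      · refine ⟨⟨hw.1, hw.2.trans hyz⟩, fun m hm hmem => ?_⟩
        rcases hcases m hm with ⟨n, hn, rfl⟩ | ⟨n, hn, rfl⟩
        · rw [hLp] at hmem
          exact hno n hn hmem
        · linarith [(hIq n hn hmem).1, hw.2]
      · refine ⟨⟨hxy.trans hw.1, hw.2⟩, fun m hm hmem => ?_⟩
        rcases hcases m hm with ⟨n, hn, rfl⟩ | ⟨n, hn, rfl⟩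
        · linarith [(hIp n hn hmem).2, hw.1]
        · rw [hLq n hn] at hmem
          exact hno n hn hmem
    · rintro ⟨hw, hno⟩
      rcases le_total w y with h | h
      · refine Or.inl ⟨⟨hw.1, h⟩, fun n hn hmem => hno (p n) (hp1 n hn) ?_⟩
        rwa [hLp]
      · refine Or.inr ⟨⟨h, hw.2⟩, fun n hn hmem => hno (q n) (hq1 n hn) ?_⟩
        rwa [hLq n hn]

/-! ### Covers of the Cantor sets -/

/-- A single scale `d ∈ [δ^(1/θ), δ]` and an index `n` with `a n ≤ d` and `n d^u ≤ ε`. Up to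
constants, this is what an efficient cover of a Cantor set amounts to: `n` measures the number of
intervals of length `d` that are needed. -/
def HasUniformScale (a : ℕ → ℝ) (θ δ u ε : ℝ) : Prop :=
  ∃ (d : ℝ) (n : ℕ), δ ^ (1 / θ) ≤ d ∧ d ≤ δ ∧ 1 ≤ n ∧ a n ≤ d ∧ n * d ^ u ≤ ε

theorem HasUniformScale.mono {a : ℕ → ℝ} {θ δ u u' ε ε' : ℝ} (h : HasUniformScale a θ δ u ε)
    (hδ : 0 < δ) (hδ1 : δ ≤ 1) (hu : u ≤ u') (hε : ε ≤ ε') : HasUniformScale a θ δ u' ε' := by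
  obtain ⟨d, n, h1, h2, h3, h4, h5⟩ := h
  refine ⟨d, n, h1, h2, h3, h4, le_trans ?_ (h5.trans hε)⟩
  exact mul_le_mul_of_nonneg_left (Real.rpow_le_rpow_of_exponent_ge
    ((Real.rpow_pos_of_pos hδ _).trans_le h1) (h2.trans hδ1) hu) (Nat.cast_nonneg n)

/-- Summing `cantorLength` over generations: by the geometric decay of `2^n a(N 2^n)` the gap at the
root dominates. -/
theorem cantorLength_comp_le {a : ℕ → ℝ} (hanti : AntitoneOn a (Ici 1))
    {K ρ : ℝ} (hρ0 : 0 < ρ) (hρ1 : ρ < 1)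
    (hdec : ∀ N, 1 ≤ N → ∀ n, 2 ^ n * a (N * 2 ^ n) ≤ K * ρ ^ n * a N)
    {κ : ℝ} (hκ : 1 ≤ κ) {p : ℕ → ℕ} (hpow : ∀ n : ℕ, (n : ℝ) ^ κ ≤ p n)
    (hs : Summable (a ∘ p)) (hc : ∀ n, 1 ≤ n → 0 < (a ∘ p) n)
    {N m : ℕ} (hN : 1 ≤ N) (hNm : (N : ℝ) ≤ ((2 : ℝ) ^ m) ^ κ) (j : ℕ) :
    cantorLength (a ∘ p) (2 ^ m + j) ≤ K / (1 - ρ) * a N := by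
  have hg : HasSum (fun n => K * ρ ^ n * a N) (K * (1 - ρ)⁻¹ * a N) :=
    ((hasSum_geometric_of_lt_one hρ0.le hρ1).mul_left K).mul_right (a N)
  rw [div_eq_mul_inv, ← hg.tsum_eq]
  refine (summable_generationSum hs hc (2 ^ m + j)
    (le_add_right Nat.one_le_two_pow)).tsum_le_tsum (fun n => ?_) hg.summable
  refine le_trans ?_ (hdec N hN n)
  have hterm : ∀ i, (a ∘ p) ((2 ^ m + j) * 2 ^ n + i) ≤ a (N * 2 ^ n) := by
    intro i
    have h1 : N * 2 ^ n ≤ p ((2 ^ m + j) * 2 ^ n + i) := by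
      have h2 : (N : ℝ) * 2 ^ n ≤ p ((2 ^ m + j) * 2 ^ n + i) := by
        calc (N : ℝ) * 2 ^ n ≤ ((2 : ℝ) ^ m) ^ κ * ((2 : ℝ) ^ n) ^ κ := by
              gcongr
              exact Real.self_le_rpow_of_one_le (one_le_pow₀ (by norm_num)) hκ
          _ = ((2 : ℝ) ^ m * 2 ^ n) ^ κ := (Real.mul_rpow (by positivity) (by positivity)).symm
          _ ≤ (((2 ^ m + j) * 2 ^ n + i : ℕ) : ℝ) ^ κ := by
              push_cast
              refine Real.rpow_le_rpow (by positivity) ?_ (by linarith)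
              have : (0 : ℝ) ≤ j * 2 ^ n + i := by positivity
              linarith
          _ ≤ _ := hpow _
      exact_mod_cast h2
    have h3 : 1 ≤ N * 2 ^ n := Nat.mul_pos hN (by positivity)
    exact hanti (mem_Ici.2 h3) (mem_Ici.2 (h3.trans h1)) h1
  have := Finset.sum_le_card_nsmul (Finset.range (2 ^ n))
    (fun i => (a ∘ p) ((2 ^ m + j) * 2 ^ n + i)) (a (N * 2 ^ n)) (fun i _ => hterm i)
  simpa using this

/-- If the `n`-th term of the subsequence sits at a position of order `n^κ` or later, then the
Cantor set has at level `m` only `2^m` intervals, each as short as the term of `a` at position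
`2^(κm)`; covering it by these divides the critical exponent by `κ`. -/
theorem hasIntermediateCover_cantorCompl {a : ℕ → ℝ} (hpos : ∀ n, 1 ≤ n → 0 < a n)
    (hanti : AntitoneOn a (Ici 1)) {K ρ : ℝ} (hρ0 : 0 < ρ) (hρ1 : ρ < 1)
    (hdec : ∀ N, 1 ≤ N → ∀ n, 2 ^ n * a (N * 2 ^ n) ≤ K * ρ ^ n * a N)
    {κ : ℝ} (hκ : 1 ≤ κ) {p : ℕ → ℕ} (hpow : ∀ n : ℕ, (n : ℝ) ^ κ ≤ p n)
    (hs : Summable (a ∘ p)) (hc : ∀ n, 1 ≤ n → 0 < (a ∘ p) n) :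
    ∃ C : ℝ, 0 < C ∧ ∀ θ δ s ε : ℝ, 0 < δ → HasUniformScale a θ δ (κ * s) ε →
      HasIntermediateCover θ δ s (C * ε ^ (1 / κ)) (cantorCompl (a ∘ p)) := by
  classical
  have hκ0 : 0 < κ := by linarith
  set C : ℕ := ⌈K / (1 - ρ)⌉₊ + 1
  have hC : K / (1 - ρ) ≤ C := by
    have := Nat.le_ceil (K / (1 - ρ))
    push_cast [C]
    linarith
  refine ⟨2 * C, by positivity, ?_⟩
  rintro θ δ s ε hδ ⟨d, N, hd1, hd2, hN, haN, hNd⟩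
  have hd0 : 0 < d := (Real.rpow_pos_of_pos hδ _).trans_le hd1
  have hN1 : (1 : ℝ) ≤ N := by exact_mod_cast hN
  have hex : ∃ m : ℕ, (N : ℝ) ≤ ((2 : ℝ) ^ m) ^ κ := by
    refine ⟨N, ?_⟩
    have h1 : (N : ℝ) ≤ 2 ^ N := by exact_mod_cast Nat.lt_two_pow_self.le
    exact h1.trans (Real.self_le_rpow_of_one_le (one_le_pow₀ (by norm_num)) hκ)
  set m := Nat.find hex with hm
  have hmN : (N : ℝ) ≤ ((2 : ℝ) ^ m) ^ κ := Nat.find_spec hex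
  have hm2 : (2 : ℝ) ^ m ≤ 2 * (N : ℝ) ^ (1 / κ) := by
    rcases Nat.eq_zero_or_pos m with h0 | h0
    · rw [h0, pow_zero]
      have := Real.one_le_rpow hN1 (show 0 ≤ 1 / κ by positivity)
      linarith
    · have h1 := Nat.find_min hex (show m - 1 < m by omega)
      rw [not_le] at h1
      have h2 : ((2 : ℝ) ^ (m - 1)) ≤ (N : ℝ) ^ (1 / κ) := by
        have := Real.rpow_le_rpow (by positivity) h1.le (show 0 ≤ 1 / κ by positivity)
        rwa [← Real.rpow_mul (by positivity), mul_one_div_cancel hκ0.ne', Real.rpow_one] at this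
      calc (2 : ℝ) ^ m = 2 * 2 ^ (m - 1) := by rw [← pow_succ']; congr 1; omega
        _ ≤ _ := by gcongr
  refine HasIntermediateCover.of_intervals (ι := Fin (2 ^ m))
    (fun j => cantorLeft (a ∘ p) m j) (fun _ => d) C (by omega) (fun _ => hd0)
    (fun _ => ⟨hd1, hd2⟩) ?_ ?_
  · intro x hx
    rw [cantorCompl_eq_iInter, mem_iInter] at hx
    obtain ⟨j, hj, hxj⟩ := mem_cantorUnion.1 (hx m)
    refine mem_iUnion.2 ⟨⟨j, hj⟩, hxj.1, hxj.2.trans ?_⟩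
    have h1 := cantorLength_comp_le hanti hρ0 hρ1 hdec hκ hpow hs hc hN hmN j
    have h2 : K / (1 - ρ) * a N ≤ C * d := by
      have := (hpos N hN).le
      gcongr
    simp only
    linarith
  · have h1 : ((N : ℝ) * d ^ (κ * s)) ^ (1 / κ) = (N : ℝ) ^ (1 / κ) * d ^ s := by
      rw [Real.mul_rpow (by positivity) (by positivity), ← Real.rpow_mul hd0.le]
      congr 2
      field_simp
    have h2 : ((N : ℝ) * d ^ (κ * s)) ^ (1 / κ) ≤ ε ^ (1 / κ) :=
      Real.rpow_le_rpow (by positivity) hNd (by positivity)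
    have h3 : 0 < d ^ s := Real.rpow_pos_of_pos hd0 s
    simp only [Finset.sum_const, Finset.card_univ, Fintype.card_fin, nsmul_eq_mul, Nat.cast_pow,
      Nat.cast_ofNat]
    calc (C : ℝ) * (2 ^ m * d ^ s) ≤ C * (2 * (N : ℝ) ^ (1 / κ) * d ^ s) := by gcongr
      _ = 2 * C * ((N : ℝ) ^ (1 / κ) * d ^ s) := by ring
      _ ≤ _ := by rw [← h1]; gcongr

/-- Between two left end points of step `m + n` that are two full blocks of `2^n` apart there lies
a whole interval of step `m`. -/
theorem cantorLeft_add_le_of_far {c : ℕ → ℝ} (hs : Summable c) (hc : ∀ n, 1 ≤ n → 0 < c n)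
    (hanti : AntitoneOn c (Ici 1)) {m n i j : ℕ} (hij : i + 2 * 2 ^ n ≤ j) (hj : j < 2 ^ (m + n)) :
    cantorLeft c (m + n) i + c (2 ^ (m + 1)) ≤ cantorLeft c (m + n) j := by
  have hW : 0 < 2 ^ n := by positivity
  set b := i / 2 ^ n + 1 with hb
  have hdm := Nat.div_add_mod i (2 ^ n)
  have hmod := Nat.mod_lt i hW
  have hb0 : b * 2 ^ n = 2 ^ n * (i / 2 ^ n) + 2 ^ n := by rw [hb]; ring
  have hb1 : i ≤ b * 2 ^ n := by omega
  have hb2 : (b + 1) * 2 ^ n ≤ j := by rw [add_mul, one_mul]; omega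
  have hb3 : b + 1 < 2 ^ m := by
    rw [pow_add] at hj
    exact lt_of_mul_lt_mul_right (hb2.trans_lt hj) hW.le
  have h1 := cantorLeft_le hs hc (m + n) i (b * 2 ^ n) hb1 (by rw [add_mul] at hb2; omega)
  have h2 := cantorLeft_le hs hc (m + n) _ j hb2 hj
  rw [cantorLeft_add_pow] at h1 h2
  have h3 := cantorLeft_add_length_lt hs hc m b hb3
  have h4 := le_cantorLength hs hc (show 1 ≤ 2 ^ m + b from le_add_right Nat.one_le_two_pow)
  have h5 : c (2 ^ (m + 1)) ≤ c (2 ^ m + b) :=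
    hanti (mem_Ici.2 (le_add_right Nat.one_le_two_pow)) (mem_Ici.2 Nat.one_le_two_pow)
      (by rw [pow_succ]; omega)
  linarith

theorem card_cantorLeft_mem_le {c : ℕ → ℝ} (hs : Summable c) (hc : ∀ n, 1 ≤ n → 0 < c n)
    (hanti : AntitoneOn c (Ici 1)) {m n : ℕ} {U : Set ℝ} (hU : Bornology.IsBounded U)
    (hUd : Metric.diam U < c (2 ^ (m + 1))) [DecidablePred fun j => cantorLeft c (m + n) j ∈ U] :
    ((Finset.range (2 ^ (m + n))).filter fun j => cantorLeft c (m + n) j ∈ U).card ≤ 2 * 2 ^ n := by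
  set J := (Finset.range (2 ^ (m + n))).filter fun j => cantorLeft c (m + n) j ∈ U with hJ
  rcases J.eq_empty_or_nonempty with h | h
  · simp [h]
  · have hi := J.min'_mem h
    set i := J.min' h
    have hsub : J ⊆ Finset.Ico i (i + 2 * 2 ^ n) := by
      intro j hj
      refine Finset.mem_Ico.2 ⟨J.min'_le j hj, ?_⟩
      by_contra hcon
      rw [hJ, Finset.mem_filter, Finset.mem_range] at hj hi
      have h1 := cantorLeft_add_le_of_far hs hc hanti (not_lt.1 hcon) hj.1
      have h2 : |cantorLeft c (m + n) j - cantorLeft c (m + n) i| ≤ Metric.diam U :=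
        Metric.dist_le_diam_of_mem hU hj.2 hi.2
      have h3 := (le_abs_self _).trans h2
      linarith
    simpa using Finset.card_le_card hsub

/-- Mass distribution: give every interval of step `m` the mass `2^(-m)`.  Some member of a cover
must carry at least its share of the mass, and its diameter `d` is an efficient single scale. -/
theorem exists_scale_of_cover_cantorCompl {c : ℕ → ℝ} (hs : Summable c)
    (hc : ∀ n, 1 ≤ n → 0 < c n) (hanti : AntitoneOn c (Ici 1)) {θ δ s ε : ℝ} (hδ : 0 < δ)
    (hε : 0 < ε) (h : HasIntermediateCover θ δ s ε (cantorCompl c)) :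
    ∃ (d : ℝ) (m : ℕ), δ ^ (1 / θ) ≤ d ∧ d ≤ δ ∧ c (2 ^ (m + 1)) ≤ d ∧ 2 ^ m * d ^ s ≤ 4 * ε := by
  classical
  obtain ⟨N, U, hcov, hd, hsum⟩ := h
  have hd0 : ∀ i, 0 < Metric.diam (U i) := fun i =>
    (Real.rpow_pos_of_pos hδ _).trans_le (hd i).1
  have hb : ∀ i, Bornology.IsBounded (U i) := fun i => by
    by_contra hb
    exact (hd0 i).ne' (Metric.diam_eq_zero_of_unbounded hb)
  have hex : ∀ i, ∃ m : ℕ, c (2 ^ (m + 1)) ≤ Metric.diam (U i) := by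
    intro i
    have h1 : Tendsto (fun m : ℕ => 2 ^ (m + 1)) atTop atTop := by
      refine tendsto_atTop_mono (fun m => ?_) tendsto_id
      have := Nat.lt_two_pow_self (n := m + 1)
      simp only [id]; omega
    have h2 := (hs.tendsto_atTop_zero.comp h1).eventually (gt_mem_nhds (hd0 i))
    obtain ⟨m, hm⟩ := h2.exists
    exact ⟨m, le_of_lt hm⟩
  -- the first step whose intervals may be as short as `U i`; so `U i` meets at most two intervals
  -- of the step before
  let μ : Fin N → ℕ := fun i => Nat.find (hex i)
  have hμ : ∀ i, c (2 ^ (μ i + 1)) ≤ Metric.diam (U i) := fun i => Nat.find_spec (hex i)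
  by_contra hcon
  push Not at hcon
  have hlt : ∀ i, 4 * ε < 2 ^ μ i * Metric.diam (U i) ^ s := fun i =>
    hcon _ _ (hd i).1 (hd i).2 (hμ i)
  set M := Finset.univ.sup μ
  have hμM : ∀ i, μ i ≤ M := fun i => Finset.le_sup (Finset.mem_univ i)
  let J : Fin N → Finset ℕ := fun i =>
    (Finset.range (2 ^ M)).filter fun j => cantorLeft c M j ∈ U i
  have hJ : ∀ i, (J i).card ≤ 4 * 2 ^ (M - μ i) := by
    intro i
    rcases Nat.eq_zero_or_pos (μ i) with h0 | h0
    · have h1 : (J i).card ≤ 2 ^ M := by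
        simpa using Finset.card_filter_le (Finset.range (2 ^ M)) fun j => cantorLeft c M j ∈ U i
      rw [h0, Nat.sub_zero]
      omega
    · have h1 : Metric.diam (U i) < c (2 ^ (μ i - 1 + 1)) :=
        not_le.1 (Nat.find_min (hex i) (show μ i - 1 < μ i by omega))
      have h2 := card_cantorLeft_mem_le hs hc hanti (n := M - (μ i - 1)) (hb i) h1
      have hM := hμM i
      have h3 : μ i - 1 + (M - (μ i - 1)) = M := by omega
      have h4 : M - (μ i - 1) = (M - μ i) + 1 := by omega
      simp only [h3] at h2
      rw [h4, pow_succ] at h2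
      refine h2.trans (le_of_eq ?_)
      ring
  have hcover : Finset.range (2 ^ M) ⊆ Finset.univ.biUnion J := by
    intro j hj
    obtain ⟨i, hi⟩ := mem_iUnion.1 (hcov (cantorLeft_mem hs hc M j (Finset.mem_range.1 hj)))
    exact Finset.mem_biUnion.2 ⟨i, Finset.mem_univ i, Finset.mem_filter.2 ⟨hj, hi⟩⟩
  have hcard : 2 ^ M ≤ ∑ i, 4 * 2 ^ (M - μ i) := by
    calc 2 ^ M = (Finset.range (2 ^ M)).card := by simp
      _ ≤ (Finset.univ.biUnion J).card := Finset.card_le_card hcover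
      _ ≤ ∑ i, (J i).card := Finset.card_biUnion_le
      _ ≤ _ := Finset.sum_le_sum fun i _ => hJ i
  have hcard' : (2 : ℝ) ^ M ≤ ∑ i, 4 * 2 ^ (M - μ i) := by exact_mod_cast hcard
  have hne : (Finset.univ : Finset (Fin N)).Nonempty := by
    by_contra hemp
    rw [Finset.not_nonempty_iff_eq_empty] at hemp
    rw [hemp, Finset.sum_empty] at hcard'
    linarith [show (0 : ℝ) < 2 ^ M by positivity]
  have hfin : ∑ i, (4 : ℝ) * 2 ^ (M - μ i) < ∑ i, 2 ^ M / ε * Metric.diam (U i) ^ s := by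
    refine Finset.sum_lt_sum_of_nonempty hne fun i _ => ?_
    have h1 : (2 : ℝ) ^ M = 2 ^ (M - μ i) * 2 ^ μ i := by
      rw [← pow_add, Nat.sub_add_cancel (hμM i)]
    rw [div_mul_eq_mul_div, lt_div_iff₀ hε, h1]
    have := mul_lt_mul_of_pos_left (hlt i) (show (0 : ℝ) < 2 ^ (M - μ i) by positivity)
    linarith
  have h1 : 2 ^ M / ε * ∑ i, Metric.diam (U i) ^ s ≤ 2 ^ M / ε * ε := by gcongr
  rw [div_mul_cancel₀ _ hε.ne', Finset.mul_sum] at h1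
  linarith

/-- The converse of `hasIntermediateCover_cantorCompl`, for subsequences whose positions grow at
most like `n^κ`. -/
theorem hasUniformScale_of_cover_cantorCompl {a : ℕ → ℝ} {κ : ℝ} (hκ : 0 < κ) {p : ℕ → ℕ}
    (hp1 : ∀ n, 1 ≤ n → 1 ≤ p n) (hpow : ∀ n : ℕ, 1 ≤ n → (p n : ℝ) ≤ 3 * (n : ℝ) ^ κ)
    (hs : Summable (a ∘ p)) (hc : ∀ n, 1 ≤ n → 0 < (a ∘ p) n)
    (hanti : AntitoneOn (a ∘ p) (Ici 1)) {θ δ s ε : ℝ} (hδ : 0 < δ) (hε : 0 < ε)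
    (h : HasIntermediateCover θ δ s ε (cantorCompl (a ∘ p))) :
    HasUniformScale a θ δ (κ * s) (3 * 2 ^ κ * (4 * ε) ^ κ) := by
  obtain ⟨d, m, h1, h2, h3, h4⟩ := exists_scale_of_cover_cantorCompl hs hc hanti hδ hε h
  have hd0 : 0 < d := (Real.rpow_pos_of_pos hδ _).trans_le h1
  refine ⟨d, p (2 ^ (m + 1)), h1, h2, hp1 _ Nat.one_le_two_pow, h3, ?_⟩
  have h5 := hpow (2 ^ (m + 1)) Nat.one_le_two_pow
  push_cast at h5
  have h6 : ((2 : ℝ) ^ (m + 1)) ^ κ = 2 ^ κ * ((2 : ℝ) ^ m) ^ κ := by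
    rw [pow_succ', Real.mul_rpow (by norm_num) (by positivity)]
  calc (p (2 ^ (m + 1)) : ℝ) * d ^ (κ * s) ≤ 3 * ((2 : ℝ) ^ (m + 1)) ^ κ * d ^ (κ * s) := by gcongr
    _ = 3 * 2 ^ κ * ((2 : ℝ) ^ m * d ^ s) ^ κ := by
      rw [h6, Real.mul_rpow (by positivity) (by positivity), ← Real.rpow_mul hd0.le, mul_comm s κ]
      ring
    _ ≤ _ := by gcongr

/-- Since `n a_n ≤ 1`, the scale `δ` needs only about `1 / δ` intervals. -/
theorem hasUniformScale_two {a : ℕ → ℝ} (hanti : AntitoneOn a (Ici 1))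
    (hpos : ∀ n, 1 ≤ n → 0 < a n) (hsum : HasSum (fun n => a (n + 1)) 1) {θ δ : ℝ} (hθ0 : 0 < θ)
    (hθ1 : θ ≤ 1) (hδ : 0 < δ) (hδ1 : δ ≤ 1) : HasUniformScale a θ δ 2 (2 * δ) := by
  set n := ⌈1 / δ⌉₊
  have hn1 : 1 ≤ n := Nat.one_le_ceil_iff.2 (by positivity)
  have h1 : 1 / δ ≤ n := Nat.le_ceil _
  have h2 : (n : ℝ) < 1 / δ + 1 := Nat.ceil_lt_add_one (by positivity)
  have h3 : 1 / δ * δ = 1 := by field_simp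
  have hn0 : (0 : ℝ) < n := by exact_mod_cast hn1
  have h4 : (n : ℝ) * a n ≤ 1 := by
    have h5 := Finset.card_nsmul_le_sum (Finset.range n) (fun i => a (i + 1)) (a n)
      (fun i hi => hanti (mem_Ici.2 (by omega)) (mem_Ici.2 hn1)
        (by have := Finset.mem_range.1 hi; omega))
    have h6 := sum_le_hasSum (Finset.range n) (fun i _ => (hpos (i + 1) (by omega)).le) hsum
    simp only [Finset.card_range, nsmul_eq_mul] at h5
    linarith
  refine ⟨δ, n, rpow_one_div_le_self hθ0 hθ1 hδ hδ1, le_rfl, hn1, ?_, ?_⟩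
  · have h7 : 1 ≤ n * δ := by
      have := mul_le_mul_of_nonneg_right h1 hδ.le
      linarith
    exact le_of_mul_le_mul_left (h4.trans h7) hn0
  · rw [Real.rpow_two]
    have h5 := mul_le_mul_of_nonneg_right h2.le (sq_nonneg δ)
    have h6 : (1 / δ + 1) * δ ^ 2 = δ + δ ^ 2 := by field_simp
    nlinarith

/-! ### Splitting the sequence -/

/-- The indices are split into a subsequence `p n` of order `n^κ` and the sequence `q` of the
remaining ones.  As `p n ≥ 2 n`, at least every second index remains, whence `q n ≤ 2 n`. -/
theorem exists_index_splitting {κ : ℝ} (hκ : 1 ≤ κ) : ∃ p q : ℕ → ℕ, StrictMono p ∧ StrictMono q ∧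
    p 0 = 0 ∧ q 0 = 0 ∧ (∀ n, 1 ≤ n → Xor (n ∈ range p) (n ∈ range q)) ∧
    (∀ n : ℕ, (n : ℝ) ^ κ ≤ p n) ∧ (∀ n : ℕ, 1 ≤ n → (p n : ℝ) ≤ 3 * (n : ℝ) ^ κ) ∧
    ∀ n, q n ≤ 2 * n := by
  classical
  let p : ℕ → ℕ := fun n => ⌈2 * (n : ℝ) ^ κ⌉₊
  have hp0 : p 0 = 0 := by simp [p, Real.zero_rpow (by linarith : κ ≠ 0)]
  have hle : ∀ n : ℕ, 2 * (n : ℝ) ^ κ ≤ p n := fun n => Nat.le_ceil _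
  have hlt : ∀ n : ℕ, (p n : ℝ) < 2 * (n : ℝ) ^ κ + 1 := fun n =>
    Nat.ceil_lt_add_one (by positivity)
  have hgap : ∀ n, p n + 1 < p (n + 1) := by
    intro n
    refine Nat.lt_ceil.2 ?_
    have h1 := Real.add_rpow_le_rpow_add (Nat.cast_nonneg n) zero_le_one hκ
    rw [Real.one_rpow] at h1
    push_cast
    linarith [hlt n]
  have hp : StrictMono p := strictMono_nat_of_lt_succ fun n => by have := hgap n; omega
  have hp2 : ∀ n, 2 * n ≤ p n := by
    intro n
    induction n with
    | zero => simp
    | succ n ih => have := hgap n; omega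
  let S : ℕ → Prop := fun n => n = 0 ∨ n ∉ range p
  have hS0 : S 0 := Or.inl rfl
  have hSinf : (ofPred S).Infinite := by
    refine Set.infinite_of_forall_exists_gt fun n => ⟨p n + 1, Or.inr ?_, ?_⟩
    · rintro ⟨m, hm⟩
      rcases Nat.lt_or_ge n m with h | h
      · have h1 := hp.monotone (show n + 1 ≤ m from h)
        have h2 := hgap n
        omega
      · have := hp.monotone h
        omega
    · have := hp2 n
      omega
  have hrange : range (Nat.nth S) = ofPred S := Nat.range_nth_of_infinite hSinf
  refine ⟨p, Nat.nth S, hp, Nat.nth_strictMono hSinf, hp0, ?_, ?_, ?_, ?_, ?_⟩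
  · simpa using Nat.nth_count hS0
  · intro n hn
    rw [hrange]
    have h : n ∈ ofPred S ↔ n ∉ range p := by
      change n = 0 ∨ n ∉ range p ↔ _
      exact or_iff_right (by omega)
    rw [h]
    by_cases h' : n ∈ range p
    · exact Or.inl ⟨h', not_not.2 h'⟩
    · exact Or.inr ⟨h', h'⟩
  · intro n
    have : 0 ≤ (n : ℝ) ^ κ := by positivity
    linarith [hle n]
  · intro n hn
    have := Real.one_le_rpow (show (1 : ℝ) ≤ n by exact_mod_cast hn) (show 0 ≤ κ by linarith)
    linarith [hlt n]
  · intro n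
    suffices h : n < Nat.count S (2 * n + 1) from Nat.le_of_lt_succ (Nat.nth_lt_of_lt_count h)
    have hsub : Finset.range (2 * n + 1) ⊆
        (Finset.range (2 * n + 1)).filter S ∪ (Finset.Icc 1 n).image p := by
      intro m hm
      by_cases hSm : S m
      · exact Finset.mem_union_left _ (Finset.mem_filter.2 ⟨hm, hSm⟩)
      · refine Finset.mem_union_right _ ?_
        simp only [S, not_or, not_not] at hSm
        obtain ⟨hm0, k, rfl⟩ := hSm
        have h1 := hp2 k
        have h2 := Finset.mem_range.1 hm
        refine Finset.mem_image.2 ⟨k, Finset.mem_Icc.2 ⟨?_, by omega⟩, rfl⟩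
        rcases Nat.eq_zero_or_pos k with rfl | h
        · exact absurd hp0 hm0
        · exact h
    have h1 := (Finset.card_le_card hsub).trans (Finset.card_union_le _ _)
    have h2 : ((Finset.Icc 1 n).image p).card ≤ n := by
      simpa using Finset.card_image_le (s := Finset.Icc 1 n) (f := p)
    have h3 : ((Finset.range (2 * n + 1)).filter S).card = Nat.count S (2 * n + 1) := by
      rw [Nat.count_eq_card_filter_range]
    rw [Finset.card_range] at h1
    omega

theorem tailSum_comp_add_tailSum_comp {a : ℕ → ℝ} (hs : Summable a) {p q : ℕ → ℕ}
    (hp : StrictMono p) (hq : StrictMono q) (hp0 : p 0 = 0) (hq0 : q 0 = 0)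
    (hpq : ∀ n, 1 ≤ n → Xor (n ∈ range p) (n ∈ range q)) :
    tailSum (a ∘ p) 1 + tailSum (a ∘ q) 1 = tailSum a 1 := by
  classical
  -- the value at the index `0`, which both ranges contain, is set to zero
  let f : ℕ → ℝ := fun n => if n = 0 then 0 else a n
  have hfa : ∀ n, f (1 + n) = a (1 + n) := fun n => if_neg (by omega)
  have hf : Summable f := by
    refine (summable_nat_add_iff 1).1 ?_
    have := (summable_nat_add_iff 1).2 hs
    simpa [f] using this
  have key : ∀ r : ℕ → ℕ, StrictMono r → r 0 = 0 →
      tailSum (a ∘ r) 1 = ∑' n, (range r).indicator f n := by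
    intro r hr hr0
    have h1 : Summable (fun n => f (r n)) := hf.comp_injective hr.injective
    rw [← tsum_subtype, tsum_range f hr.injective, h1.tsum_eq_zero_add, hr0]
    simp only [f, if_true, zero_add, tailSum, Function.comp]
    refine tsum_congr fun n => ?_
    have h2 : n + 1 ≤ r (n + 1) := hr.le_apply
    rw [if_neg (by omega), add_comm]
  have hid : tailSum a 1 = ∑' n, f n := by
    rw [hf.tsum_eq_zero_add]
    simp only [f, tailSum]
    simp [add_comm]
  rw [key p hp hp0, key q hq hq0, hid, ← (hf.indicator _).tsum_add (hf.indicator _)]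
  refine tsum_congr fun n => ?_
  rcases Nat.eq_zero_or_pos n with rfl | hn
  · simp [indicator, f]
  · rcases hpq n hn with ⟨h1, h2⟩ | ⟨h1, h2⟩
    · rw [indicator_of_mem h1, indicator_of_notMem h2, add_zero]
    · rw [indicator_of_mem h1, indicator_of_notMem h2, zero_add]

/-- A termwise bound between two sequences is a Lipschitz bound between their countable sets,
since distances in `D_c` are sums of consecutive terms of `c`. -/
theorem abs_countablePoint_sub_le {c c' : ℕ → ℝ} (hs : Summable c) (hs' : Summable c')
    (hc : ∀ n, 1 ≤ n → 0 < c n) (hc' : ∀ n, 1 ≤ n → 0 < c' n) {K : ℝ}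
    (hK : ∀ n, 1 ≤ n → c' n ≤ K * c n) (i j : ℕ) :
    |countablePoint c' i - countablePoint c' j| ≤
      K * |countablePoint c i - countablePoint c j| := by
  have hsh : ∀ {c : ℕ → ℝ}, Summable c → ∀ k, Summable fun i => c (k + i) := fun h k => by
    simpa [add_comm] using (summable_nat_add_iff k).2 h
  have hK0 : 0 ≤ K :=
    nonneg_of_mul_nonneg_left ((hc' 1 le_rfl).le.trans (hK 1 le_rfl)) (hc 1 le_rfl)
  have key : ∀ i j, 1 ≤ i → (j = 0 ∨ i ≤ j) →
      |countablePoint c' i - countablePoint c' j| ≤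
        K * |countablePoint c i - countablePoint c j| := by
    intro i j hi hij
    have h1 : 0 ≤ countablePoint c' i - countablePoint c' j ∧
        countablePoint c' i - countablePoint c' j ≤
          K * (countablePoint c i - countablePoint c j) := by
      rcases hij with rfl | hij
      · simp only [countablePoint, if_neg (show i ≠ 0 by omega), if_true, sub_zero]
        refine ⟨tailSum_nonneg hc' hi, ?_⟩
        rw [tailSum, tailSum, ← tsum_mul_left]
        exact (hsh hs' i).tsum_le_tsum (fun n => hK _ (by omega)) ((hsh hs i).mul_left K)
      · obtain ⟨k, rfl⟩ := Nat.exists_eq_add_of_le hij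
        simp only [countablePoint, if_neg (show i ≠ 0 by omega), if_neg (show i + k ≠ 0 by omega)]
        rw [tailSum_eq_sum_add hs i k, tailSum_eq_sum_add hs' i k, add_sub_cancel_right,
          add_sub_cancel_right, Finset.mul_sum]
        exact ⟨Finset.sum_nonneg fun n _ => (hc' _ (by omega)).le,
          Finset.sum_le_sum fun n _ => hK _ (by omega)⟩
    rw [abs_of_nonneg h1.1]
    exact h1.2.trans (mul_le_mul_of_nonneg_left (le_abs_self _) hK0)
  rcases Nat.eq_zero_or_pos i with rfl | hi
  · rcases Nat.eq_zero_or_pos j with rfl | hj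
    · simp
    · rw [abs_sub_comm, abs_sub_comm (countablePoint c 0)]
      exact key j 0 hj (Or.inl rfl)
  · rcases le_total i j with h | h
    · exact key i j hi (Or.inr h)
    · rcases Nat.eq_zero_or_pos j with rfl | hj
      · exact key i 0 hi (Or.inl rfl)
      · rw [abs_sub_comm, abs_sub_comm (countablePoint c i)]
        exact key j i hj (Or.inr h)

/-! ### Dimensions -/

/-- The common features of "for all small `δ`" and "for arbitrarily small `δ`", which make it
possible to treat the upper and the lower dimension at once. -/
structure IsScaleQuantifier (Q : (ℝ → Prop) → Prop) : Prop where
  mono : ∀ {P P' : ℝ → Prop} (δ₁ : ℝ), 0 < δ₁ → (∀ δ, 0 < δ → δ ≤ δ₁ → P δ → P' δ) → Q P → Q P'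
  univ : Q fun _ => True

theorem isScaleQuantifier_eventually :
    IsScaleQuantifier fun P => ∃ δ₀ > 0, ∀ δ, 0 < δ → δ ≤ δ₀ → P δ where
  mono := by
    rintro P P' δ₁ hδ₁ h ⟨δ₀, hδ₀, h'⟩
    exact ⟨min δ₀ δ₁, lt_min hδ₀ hδ₁, fun δ h1 h2 =>
      h δ h1 (h2.trans (min_le_right _ _)) (h' δ h1 (h2.trans (min_le_left _ _)))⟩
  univ := ⟨1, one_pos, fun _ _ _ => trivial⟩

theorem isScaleQuantifier_frequently :
    IsScaleQuantifier fun P => ∀ δ₀ > 0, ∃ δ, 0 < δ ∧ δ ≤ δ₀ ∧ P δ where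
  mono := by
    intro P P' δ₁ hδ₁ h h' δ₀ hδ₀
    obtain ⟨δ, h1, h2, h3⟩ := h' (min δ₀ δ₁) (lt_min hδ₀ hδ₁)
    exact ⟨δ, h1, h2.trans (min_le_left _ _), h δ h1 (h2.trans (min_le_right _ _)) h3⟩
  univ := fun δ₀ hδ₀ => ⟨δ₀, hδ₀, le_rfl, trivial⟩

/-- The `θ`-intermediate dimension in which the scales `δ` are quantified by `Q`. -/
noncomputable def scaleDim (Q : (ℝ → Prop) → Prop) (θ : ℝ) (F : Set ℝ) : ℝ :=
  sInf {s : ℝ | 0 ≤ s ∧ ∀ ε > 0, Q fun δ => HasIntermediateCover θ δ s ε F}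

/-- The pair `(u, s)` is a joint exponent if, at one and the same scale `δ`, the Cantor part of a
union is cheap to cover at the exponent `u` (measured in terms of `a`) and the countable part at the
exponent `s`. -/
def JointExponent (Q : (ℝ → Prop) → Prop) (a : ℕ → ℝ) (θ u s : ℝ) : Prop :=
  ∀ ε > 0, Q fun δ => HasUniformScale a θ δ u ε ∧ HasIntermediateCover θ δ s ε (countableCompl a)

theorem JointExponent.mono {Q : (ℝ → Prop) → Prop} (hQ : IsScaleQuantifier Q) {a : ℕ → ℝ}
    {θ u u' s s' : ℝ} (hu : u ≤ u') (hs : s ≤ s') (h : JointExponent Q a θ u s) :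
    JointExponent Q a θ u' s' := fun ε hε =>
  hQ.mono 1 one_pos (fun _ h1 h2 h3 => ⟨h3.1.mono h1 h2 hu le_rfl, h3.2.mono h1 h2 hs le_rfl⟩)
    (h ε hε)

/-- Along the rays `u = κ s` the boundary of an upward closed set of pairs `(u, s)` takes every
intermediate height. -/
theorem exists_slope_sInf_eq {P : ℝ → ℝ → Prop}
    (hP : ∀ u u' s s', u ≤ u' → s ≤ s' → P u s → P u' s') {t : ℝ} (ht : 0 < t)
    (h0 : ∀ s, 0 ≤ s → P s s → t ≤ s) {u : ℝ} (h1 : P u t) :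
    ∃ κ, 1 ≤ κ ∧ sInf {s | 0 ≤ s ∧ P (κ * s) s} = t := by
  set W := {κ : ℝ | 1 ≤ κ ∧ P (κ * t) t} with hW
  have hbdd : BddBelow W := ⟨1, fun κ hκ => hκ.1⟩
  have hne : W.Nonempty := by
    refine ⟨max 1 (u / t), le_max_left _ _, hP _ _ _ _ ?_ le_rfl h1⟩
    rw [← div_le_iff₀ ht]
    exact le_max_right _ _
  -- the smallest slope whose ray reaches the height `t` inside the set
  set κ := sInf W
  have hκ : 1 ≤ κ := le_csInf hne fun κ hκ => hκ.1
  refine ⟨κ, hκ, ?_⟩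
  have hgt : ∀ s, t < s → P (κ * s) s := by
    intro s hs
    have h2 : κ < κ * s / t := by
      rw [lt_div_iff₀ ht]
      exact mul_lt_mul_of_pos_left hs (by linarith)
    obtain ⟨κ', hκ', hlt⟩ := exists_lt_of_csInf_lt hne h2
    refine hP _ _ _ _ ?_ hs.le hκ'.2
    rw [lt_div_iff₀ ht] at hlt
    exact hlt.le
  refine csInf_eq_of_forall_ge_of_forall_gt_exists_lt ?_ ?_ ?_
  · exact ⟨t + 1, by linarith, hgt _ (by linarith)⟩
  · rintro s ⟨hs0, hs⟩
    by_contra hlt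
    -- a lower point `(κ s, s)` could be raised to height `t`, on a ray of smaller slope `κ s / t`;
    -- that this slope is still at least `1` is the condition on the diagonal
    rw [not_le] at hlt
    have h2 : t ≤ κ * s := h0 _ (by positivity) (hP _ _ _ _ le_rfl (by nlinarith) hs)
    have h3 : κ * s / t ∈ W := by
      refine ⟨by rwa [one_le_div ht], ?_⟩
      rw [div_mul_cancel₀ _ ht.ne']
      exact hP _ _ _ _ le_rfl hlt.le hs
    have h4 := csInf_le hbdd h3
    rw [le_div_iff₀ ht] at h4
    have := mul_lt_mul_of_pos_left hlt (show 0 < κ by linarith)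
    linarith
  · intro w hw
    exact ⟨(t + w) / 2, ⟨by linarith, hgt _ (by linarith)⟩, by linarith⟩

/-- With `κ` from `exists_slope_sInf_eq`, the exponents that work for `C_b ∪ (r + D_{a'})` are
exactly the `s` for which `(κ s, s)` is a joint exponent. -/
theorem exists_complementarySet_scaleDim_eq {Q : (ℝ → Prop) → Prop} (hQ : IsScaleQuantifier Q)
    {θ : ℝ} (hθ0 : 0 < θ) (hθ1 : θ ≤ 1) {a : ℕ → ℝ}
    (hpos : ∀ n, 1 ≤ n → 0 < a n) (hanti : AntitoneOn a (Ici 1))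
    (hsum : HasSum (fun n => a (n + 1)) 1)
    (hinf : 2 < ⨅ n : ℕ, avgLength a n / avgLength a (n + 1))
    (hsup : BddAbove (range fun n : ℕ => avgLength a n / avgLength a (n + 1)))
    {t : ℝ} (ht : t ∈ Icc (scaleDim Q θ (countableCompl a)) (scaleDim Q θ (cantorCompl a))) :
    ∃ E ∈ complementarySets a, scaleDim Q θ E = t ∧
      (E = countableCompl a ∨ E = cantorCompl a ∨ IsCantorCountableUnion a E) := by
  have hs : Summable a := (summable_nat_add_iff 1).1 hsum.summable
  have htail : tailSum a 1 = 1 := by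
    rw [← hsum.tsum_eq]
    simp [tailSum, add_comm]
  have hD := hasGaps_countableCompl hs hpos 0
  simp only [zero_add, image_id', htail] at hD
  rcases eq_or_lt_of_le ht.1 with heq | hlt
  · exact ⟨countableCompl a, hD, heq, Or.inl rfl⟩
  obtain ⟨K, ρ, hK, hρ0, hρ1, hdec, hdbl⟩ := exists_geometric_decay hpos hanti hs hinf hsup
  have ht0 : 0 < t := (Real.sInf_nonneg fun s hs => hs.1).trans_lt hlt
  have hDIcc : countableCompl a ⊆ Icc 0 1 := by
    obtain ⟨l, _, _, h⟩ := hD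
    rw [h]
    exact sdiff_subset
  -- the countable part alone has an exponent below `t`
  have hDt : ∀ ε > 0, Q fun δ => HasIntermediateCover θ δ t ε (countableCompl a) := by
    have hne : {s : ℝ | 0 ≤ s ∧
        ∀ ε > 0, Q fun δ => HasIntermediateCover θ δ s ε (countableCompl a)}.Nonempty := by
      refine ⟨2, by norm_num, fun ε hε => ?_⟩
      refine hQ.mono (min 1 (ε / 2)) (by positivity) (fun δ h1 h2 _ => ?_) hQ.univ
      have h3 := h2.trans (min_le_left _ _)
      have h4 := h2.trans (min_le_right _ _)
      exact ((hasIntermediateCover_Icc_zero_one hθ0 hθ1 h1 h3).mono_set hDIcc).mono h1 h3 le_rfl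
        (by linarith)
    obtain ⟨s, hs, hst⟩ := exists_lt_of_csInf_lt hne hlt
    exact fun ε hε => hQ.mono 1 one_pos (fun δ h1 h2 h3 => h3.mono h1 h2 hst.le le_rfl) (hs.2 ε hε)
  have hJ2 : JointExponent Q a θ 2 t := by
    intro ε hε
    refine hQ.mono (min 1 (ε / 2)) (by positivity) (fun δ h1 h2 h3 => ⟨?_, h3⟩) (hDt ε hε)
    have h4 := h2.trans (min_le_left _ _)
    have h5 := h2.trans (min_le_right _ _)
    exact (hasUniformScale_two hanti hpos hsum hθ0 hθ1 h1 h4).mono h1 h4 le_rfl (by linarith)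
  have hJ1 : ∀ s, 0 ≤ s → JointExponent Q a θ s s → t ≤ s := by
    intro s hs0 hJ
    refine ht.2.trans (csInf_le ⟨0, fun s hs => hs.1⟩ ⟨hs0, fun ε hε => ?_⟩)
    obtain ⟨C, hC, hcov⟩ := hasIntermediateCover_cantorCompl (p := id) hpos hanti hρ0 hρ1 hdec
      le_rfl (fun n => by simp) hs hpos
    refine hQ.mono 1 one_pos (fun δ h1 h2 h3 => ?_) (hJ (ε / C) (by positivity))
    have h4 := hcov θ δ s (ε / C) h1 (by simpa using h3.1)
    rw [div_one, Real.rpow_one, mul_div_cancel₀ _ hC.ne'] at h4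
    exact h4
  obtain ⟨κ, hκ, hκt⟩ := exists_slope_sInf_eq
    (fun u u' s s' hu hs => JointExponent.mono hQ hu hs) ht0 hJ1 hJ2
  obtain ⟨p, q, hp, hq, hp0, hq0, hpq, hpow, hpow', hq2⟩ := exists_index_splitting hκ
  have hκ0 : 0 < κ := by linarith
  have hp1 : ∀ n, 1 ≤ n → 1 ≤ p n := fun n hn => hn.trans hp.le_apply
  have hq1 : ∀ n, 1 ≤ n → 1 ≤ q n := fun n hn => hn.trans hq.le_apply
  have hsp : Summable (a ∘ p) := hs.comp_injective hp.injective
  have hsq : Summable (a ∘ q) := hs.comp_injective hq.injective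
  have hcp : ∀ n, 1 ≤ n → 0 < (a ∘ p) n := fun n hn => hpos _ (hp1 n hn)
  have hcq : ∀ n, 1 ≤ n → 0 < (a ∘ q) n := fun n hn => hpos _ (hq1 n hn)
  have hantip : AntitoneOn (a ∘ p) (Ici 1) := fun m hm n hn hmn =>
    hanti (mem_Ici.2 (hp1 m hm)) (mem_Ici.2 (hp1 n hn)) (hp.monotone hmn)
  set r := tailSum (a ∘ p) 1
  have hr : r + tailSum (a ∘ q) 1 = 1 := by
    rw [← htail]
    exact tailSum_comp_add_tailSum_comp hs hp hq hp0 hq0 hpq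
  set E := cantorCompl (a ∘ p) ∪ (fun x => r + x) '' countableCompl (a ∘ q)
  have hE : HasGaps a 0 1 E := by
    have h2 := hasGaps_countableCompl hsq hcq r
    have h3 := tailSum_nonneg hcq le_rfl
    refine HasGaps.union hp hq hp0 hq0 hpq (tailSum_nonneg hcp le_rfl) (by linarith)
      (hasGaps_cantorCompl hsp hcp) (hr ▸ h2)
  refine ⟨E, hE, ?_, Or.inr (Or.inr ⟨p, q, hp, hq, hp0, hq0, hpq, rfl⟩)⟩
  rw [← hκt]
  -- `D_{a'}`, translated by `r`, is bi-Lipschitz to `D_a`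
  have himage : (fun x => r + x) '' countableCompl (a ∘ q) =
      range fun k => r + countablePoint (a ∘ q) k := by
    rw [countableCompl_eq_range, ← range_comp]
    rfl
  have hto : ∀ i j, |(r + countablePoint (a ∘ q) i) - (r + countablePoint (a ∘ q) j)| ≤
      (1 : ℕ) * |countablePoint a i - countablePoint a j| := by
    intro i j
    rw [add_sub_add_left_eq_sub]
    refine abs_countablePoint_sub_le hs hsq hpos hcq (fun n hn => ?_) i j
    simpa using hanti (mem_Ici.2 hn) (mem_Ici.2 (hq1 n hn)) hq.le_apply
  set L : ℕ := ⌈K⌉₊ + 1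
  have hKL : K ≤ L := by
    have := Nat.le_ceil K
    push_cast [L]
    linarith
  have hfrom : ∀ i j, |countablePoint a i - countablePoint a j| ≤
      L * |(r + countablePoint (a ∘ q) i) - (r + countablePoint (a ∘ q) j)| := by
    intro i j
    rw [add_sub_add_left_eq_sub]
    refine abs_countablePoint_sub_le hsq hs hcq hpos (fun n hn => ?_) i j
    calc a n ≤ K * a (2 * n) := hdbl n hn
      _ ≤ K * a (q n) := by
        gcongr
        exact hanti (mem_Ici.2 (hq1 n hn)) (mem_Ici.2 (by omega)) (hq2 n)
      _ ≤ L * a (q n) := by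
        have := (hpos _ (hq1 n hn)).le
        gcongr
  obtain ⟨C, hC, hcov⟩ := hasIntermediateCover_cantorCompl hpos hanti hρ0 hρ1 hdec hκ hpow hsp hcp
  unfold scaleDim
  congr 1
  ext s
  refine and_congr_right fun hs0 => ⟨fun h ε hε => ?_, fun h ε hε => ?_⟩
  -- in either direction `η` is chosen to undo the constants and powers lost in passing between
  -- covers of the two parts and the joint condition
  · set η := min ((ε / (3 * 2 ^ κ)) ^ (1 / κ) / 4) (ε / (2 * L))
    have hη : 0 < η := by positivity
    refine hQ.mono 1 one_pos (fun δ h1 h2 h3 => ⟨?_, ?_⟩) (h η hη)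
    · refine (hasUniformScale_of_cover_cantorCompl hκ0 hp1 hpow' hsp hcp hantip h1 hη
        (h3.mono_set subset_union_left)).mono h1 h2 le_rfl ?_
      have h4 : 4 * η ≤ (ε / (3 * 2 ^ κ)) ^ (1 / κ) := by
        have : η ≤ (ε / (3 * 2 ^ κ)) ^ (1 / κ) / 4 := min_le_left _ _
        linarith
      have h5 := Real.rpow_le_rpow (by positivity) h4 hκ0.le
      rw [← Real.rpow_mul (by positivity), one_div_mul_cancel hκ0.ne', Real.rpow_one] at h5
      rwa [le_div_iff₀' (by positivity)] at h5
    · have h4 := h3.mono_set (subset_union_right : (fun x => r + x) '' countableCompl (a ∘ q) ⊆ E)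
      rw [himage] at h4
      have h5 := HasIntermediateCover.of_dist_le h1 (by omega) hfrom h4
      rw [countableCompl_eq_range]
      refine h5.mono h1 h2 le_rfl ?_
      have h6 : η ≤ ε / (2 * L) := min_le_right _ _
      rwa [le_div_iff₀' (by positivity)] at h6
  · set η := min ((ε / (2 * C)) ^ κ) (ε / 4)
    have hη : 0 < η := by positivity
    refine hQ.mono 1 one_pos (fun δ h1 h2 h3 => ?_) (h η hη)
    have h4 := hcov θ δ s η h1 h3.1
    have h5 := h3.2
    rw [countableCompl_eq_range] at h5
    have h6 := HasIntermediateCover.of_dist_le h1 le_rfl hto h5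
    rw [← himage] at h6
    refine (h4.union h6).mono h1 h2 le_rfl ?_
    have h7 : η ^ (1 / κ) ≤ ε / (2 * C) := by
      have := Real.rpow_le_rpow hη.le (min_le_left _ _ : η ≤ (ε / (2 * C)) ^ κ)
        (show 0 ≤ 1 / κ by positivity)
      rwa [← Real.rpow_mul (by positivity), mul_one_div_cancel hκ0.ne', Real.rpow_one] at this
    have h8 : η ≤ ε / 4 := min_le_right _ _
    rw [le_div_iff₀' (by positivity)] at h7
    push_cast
    linarith

theorem mainTheorem5 (θ : ℝ) (hθ0 : 0 < θ) (hθ1 : θ ≤ 1) (a : ℕ → ℝ)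
    (hpos : ∀ n, 1 ≤ n → 0 < a n) (hanti : AntitoneOn a (Set.Ici 1))
    (hsum : HasSum (fun n => a (n + 1)) 1)
    (hinf : 2 < ⨅ n : ℕ, avgLength a n / avgLength a (n + 1))
    (hsup : BddAbove (Set.range fun n : ℕ => avgLength a n / avgLength a (n + 1))) :
    (∀ t ∈ Set.Icc (upperIntermediateDim θ (countableCompl a))
        (upperIntermediateDim θ (cantorCompl a)),
      ∃ E ∈ complementarySets a, upperIntermediateDim θ E = t ∧
        (E = countableCompl a ∨ E = cantorCompl a ∨ IsCantorCountableUnion a E)) ∧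
    (∀ t ∈ Set.Icc (lowerIntermediateDim θ (countableCompl a))
        (lowerIntermediateDim θ (cantorCompl a)),
      ∃ E ∈ complementarySets a, lowerIntermediateDim θ E = t ∧
        (E = countableCompl a ∨ E = cantorCompl a ∨ IsCantorCountableUnion a E)) :=
  ⟨fun _ ht => exists_complementarySet_scaleDim_eq isScaleQuantifier_eventually hθ0 hθ1 hpos hanti
      hsum hinf hsup ht,
    fun _ ht => exists_complementarySet_scaleDim_eq isScaleQuantifier_frequently hθ0 hθ1 hpos hanti
      hsum hinf hsup ht⟩
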